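/- All graphs are finite, simple and undirected. For a graph $G$ and $S\subseteq V(G)$ let $N(S)$ be the set of vertices having a neighbour in $S$ and let $N[S]=S\cup N(S)$. An independent set $S$ of $G$ is a critical independent set if $|S|-|N(S)|$ is largest possible among all independent sets of $G$. Let $\mathrm{diadem}(G)$ be the union of all critical independent sets of $G$, and $\mathrm{nucleus}(G)$ the intersection of all critical independent sets of maximum cardinality. Let $D(G)$ be the set of vertices missed by some maximum matching of $G$, $A(G)$ the set of vertices outside $D(G)$ that are adjacent to a vertex of $D(G)$, and $C(G)=V(G)\setminus(D(G)\cup A(G))$. Let $Y$ be the set of vertices of the nontrivial components of $G[D(G)]$, that is, $Y=D(G)\setminus X$ where $X$ is the set of isolated vertices of $G[D(G)]$. A graph is almost bipartite if it has exactly one odd cycle, and König–Egerváry if the maximum size of an independent set plus the maximum size of a matching equals the number of vertices. For a matching $M$, an $M$-blossom is an odd cycle of length $2k+1$ with $k$ edges in $M$; its base is the vertex of the cycle that lies on no edge of the cycle in $M$. An $M$-flower consists of an $M$-blossom and an $M$-alternating path of even length (possibly zero) from its base to a vertex not saturated by $M$, such that the base is the only common vertex of the path and the blossom. For an odd cycle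 $Q$ of $G$, $R(Q)$ is the set of all vertices that belong to some $M$-flower with blossom $Q$ for some maximum matching $M$ of $G$. A graph $G$ is a BAB-graph if, for some $k\ge 0$, it arises from the disjoint union of a (possibly empty) bipartite graph $B$ and almost bipartite non-König–Egerváry graphs $G_1,\dots,G_k$, where $R(Q_i)=V(G_i)$ for the unique odd cycle $Q_i$ of $G_i$, by adding edges between vertices of different graphs among $B,G_1,\dots,G_k$ such that every vertex of $B$ incident with an added edge lies in $A(B)\cup C(B)$, and every vertex of $G_i$ incident with an added edge lies in $A(G_i)$, for $i=1,\dots,k$. **Theorem.** Let $G$ be a BAB-graph. Then $$N[\mathrm{diadem}(G)]\cup Y=V(G)\quad\text{and}\quad N[\mathrm{diadem}(G)]\cap Y=\emptyset .$$ Moreover, the sets $\mathrm{nucleus}(G)$, $D(G)\setminus\mathrm{nucleus}(G)$, $A(G)$ and $C(G)$ are pairwise disjoint and their union is $V(G)$ (some of them may be empty). -/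

import Mathlib

namespace BAB

open SimpleGraph

variable {V : Type*}

/-- The set `N(S)` of all vertices that have a neighbour in `S`. -/
def nbhd (G : SimpleGraph V) (S : Set V) : Set V := {v | ∃ u ∈ S, G.Adj u v}

/-- The closed neighbourhood `N[S] = S ∪ N(S)`. -/
def closedNbhd (G : SimpleGraph V) (S : Set V) : Set V := S ∪ nbhd G S

/-- The vertices of `S` with a neighbour outside `S`. -/
def boundary (G : SimpleGraph V) (S : Set V) : Set V := {v | v ∈ S ∧ ∃ w, w ∉ S ∧ G.Adj v w}

/-! ### Critical independent sets -/

/-- The difference `|S| - |N(S)|`. -/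
noncomputable def diff (G : SimpleGraph V) (S : Set V) : ℤ := (S.ncard : ℤ) - ((nbhd G S).ncard : ℤ)

/-- `S` is independent and has the largest difference among all independent sets. -/
def IsCriticalIndep (G : SimpleGraph V) (S : Set V) : Prop :=
  G.IsIndepSet S ∧ ∀ T : Set V, G.IsIndepSet T → diff G T ≤ diff G S

/-- A critical independent set of maximum cardinality. -/
def IsMaximumCriticalIndep (G : SimpleGraph V) (S : Set V) : Prop :=
  IsCriticalIndep G S ∧ ∀ T : Set V, IsCriticalIndep G T → T.ncard ≤ S.ncard

/-- The intersection of all maximum critical independent sets. -/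
def nucleus (G : SimpleGraph V) : Set V := {v | ∀ S : Set V, IsMaximumCriticalIndep G S → v ∈ S}

/-- The union of all critical independent sets. -/
def diadem (G : SimpleGraph V) : Set V := {v | ∃ S : Set V, IsCriticalIndep G S ∧ v ∈ S}

/-! ### Maximum matchings and the Gallai–Edmonds sets -/

/-- `M` is a matching with the largest number of edges. -/
def IsMaximumMatching (G : SimpleGraph V) (M : G.Subgraph) : Prop :=
  M.IsMatching ∧ ∀ M' : G.Subgraph, M'.IsMatching → M'.edgeSet.ncard ≤ M.edgeSet.ncard

/-- The matching number `μ(G)`. -/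
noncomputable def matchingNumber (G : SimpleGraph V) : ℕ :=
  sSup {n | ∃ M : G.Subgraph, M.IsMatching ∧ M.edgeSet.ncard = n}

/-- `α(G) + μ(G) = |V(G)|`. -/
def IsKonigEgervary (G : SimpleGraph V) : Prop := G.indepNum + matchingNumber G = Nat.card V

/-- The vertices missed by some maximum matching. -/
def geD (G : SimpleGraph V) : Set V := {v | ∃ M : G.Subgraph, IsMaximumMatching G M ∧ v ∉ M.verts}

/-- The vertices outside `D(G)` that are adjacent to a vertex of `D(G)`. -/
def geA (G : SimpleGraph V) : Set V := {v | v ∉ geD G ∧ ∃ u ∈ geD G, G.Adj u v}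

/-- The remaining vertices. -/
def geC (G : SimpleGraph V) : Set V := (geD G ∪ geA G)ᶜ

/-- The isolated vertices of `G[D(G)]`. -/
def setX (G : SimpleGraph V) : Set V := {v | v ∈ geD G ∧ ∀ u ∈ geD G, ¬ G.Adj v u}

/-- The vertices of the nontrivial components of `G[D(G)]`. -/
def setY (G : SimpleGraph V) : Set V := geD G \ setX G

/-! ### Odd cycles and flowers -/

/-- `C` is an odd cycle of `G`, as a subgraph. -/
def IsOddCycle (G : SimpleGraph V) (C : G.Subgraph) : Prop :=
  ∃ (u : V) (p : G.Walk u u), p.IsCycle ∧ Odd p.length ∧ p.toSubgraph = C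

/-- `G` has exactly one odd cycle. -/
def IsAlmostBipartite (G : SimpleGraph V) : Prop := ∃! C : G.Subgraph, IsOddCycle G C

/-- `C` is an odd cycle of length `2k + 1` with `k` edges in `M`. -/
def IsBlossom (G : SimpleGraph V) (M C : G.Subgraph) : Prop :=
  IsOddCycle G C ∧ C.edgeSet.ncard = 2 * (C.edgeSet ∩ M.edgeSet).ncard + 1

/-- `b` is the vertex of `C` that lies on no edge of `C` in `M`. -/
def IsBase (G : SimpleGraph V) (M C : G.Subgraph) (b : V) : Prop :=
  b ∈ C.verts ∧ ∀ w, ¬ (C.Adj b w ∧ M.Adj b w)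

/-- Of any two consecutive edges of the walk, exactly one belongs to `M`. -/
def IsAlternatingWalk (G : SimpleGraph V) (M : G.Subgraph) {u v : V} (p : G.Walk u v) : Prop :=
  p.edges.IsChain fun e f => Xor (e ∈ M.edgeSet) (f ∈ M.edgeSet)

/-- The `M`-blossom `C` with base `b` and the `M`-stem `p`, which leads from `b` to the root `r`,
form an `M`-flower. -/
def IsFlower (G : SimpleGraph V) (M C : G.Subgraph) {b r : V} (p : G.Walk b r) : Prop :=
  IsBlossom G M C ∧ IsBase G M C b ∧ p.IsPath ∧ Even p.length ∧ IsAlternatingWalk G M p ∧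
    r ∉ M.verts ∧ ∀ v ∈ p.support, v ∈ C.verts → v = b

/-- The reach set `R(C)`: all vertices of `M`-flowers with blossom `C`, for all maximum
matchings `M`. -/
def reachSet (G : SimpleGraph V) (C : G.Subgraph) : Set V :=
  {v | ∃ M : G.Subgraph, IsMaximumMatching G M ∧ ∃ (b r : V) (p : G.Walk b r),
    IsFlower G M C p ∧ (v ∈ C.verts ∨ v ∈ p.support)}

/-! ### BAB-graphs -/

/-- The vertex sets `B` and `P 1, …, P k` exhibit `G` as a BAB-graph: they partition the vertices;
`G[B]` is bipartite; each `G[P i]` is almost bipartite, not König–Egerváry, and equal to the reach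
set of its odd cycle; vertices of `B` with neighbours outside `B` lie in `A(G[B]) ∪ C(G[B])`, and
vertices of `P i` with neighbours outside `P i` lie in `A(G[P i])`. -/
structure IsBABDecomposition (G : SimpleGraph V) {k : ℕ} (B : Set V) (P : Fin k → Set V) :
    Prop where
  cover : B ∪ (⋃ i, P i) = Set.univ
  disjoint_base : ∀ i, Disjoint B (P i)
  disjoint_parts : ∀ i j, i ≠ j → Disjoint (P i) (P j)
  bipartite : (G.induce B).IsBipartite
  almostBipartite : ∀ i, IsAlmostBipartite (G.induce (P i))
  not_konigEgervary : ∀ i, ¬ IsKonigEgervary (G.induce (P i))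
  reach : ∀ i, ∀ C : (G.induce (P i)).Subgraph, IsOddCycle (G.induce (P i)) C →
    reachSet (G.induce (P i)) C = Set.univ
  boundary_base : boundary G B ⊆ Subtype.val '' (geA (G.induce B) ∪ geC (G.induce B))
  boundary_parts : ∀ i, boundary G (P i) ⊆ Subtype.val '' geA (G.induce (P i))

/-- `G` is a BAB-graph. -/
def IsBABGraph (G : SimpleGraph V) : Prop :=
  ∃ (k : ℕ) (B : Set V) (P : Fin k → Set V), IsBABDecomposition G B P

end BAB

namespace BAB

open SimpleGraph Function

/-! The theorem is read off from a partition of Gallai–Edmonds type (`IsCertificate`): a barrier A,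
a set X with neighbours only in A, odd sets Q i with neighbours only in A and in Q i itself, and a
bipartite rest R. For every choice of one vertex in each Q i there is a "tight" matching that misses
these vertices, pairs off the rest of each Q i, sends A into X and pairs off R. A parity count shows
that tight matchings are maximum, so D(G) is the union of X and the Q i, and Y is the union of the Q
i.

Given an independent set S, choose the missed vertices outside S, and in N(S) where possible. The
matching injects the saturated part of S into N(S), and the unsaturated part lies in X minus the
partners of A. Hence |S| - |N(S)| ≤ |X| - |A|, strictly if N(S) meets some Q i
(`ncard_le_of_isIndepSet`). The bound is attained by X together with either colour class of R. So
critical sets and their neighbourhoods avoid Y, while X, R and A = N(X) are all covered by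
N[diadem]. The two sets built from the colour classes are maximum critical and meet in X, so the
nucleus lies in X and hence in D(G).

The certificate is glued from the pieces (`exists_isCertificate`), because vertices in D of a piece
have no neighbours outside that piece. For the bipartite piece König's theorem supplies the
structure. In an odd piece, flowers make every cycle vertex missable. Deleting a cycle edge that two
given maximum matchings avoid reduces the remaining claims to the bipartite case. -/

/-- A matching of `G`, encoded as the involution that exchanges the ends of its edges and fixes the
unsaturated vertices. -/
structure IsPairing {V : Type*} (G : SimpleGraph V) (m : V → V) : Prop where
  invol : ∀ v, m (m v) = v
  adj : ∀ v, m v ≠ v → G.Adj v (m v)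

/-- A pairing with the fewest fixed points. -/
def IsMaxPairing {V : Type*} (G : SimpleGraph V) (m : V → V) : Prop :=
  IsPairing G m ∧ ∀ m', IsPairing G m' → (fixedPoints m).ncard ≤ (fixedPoints m').ncard

/-! ### Maximum matchings as involutions -/

section Pairing

variable {V : Type*} {G : SimpleGraph V} {m : V → V}

theorem IsPairing.injective (hm : IsPairing G m) : Injective m :=
  Involutive.injective hm.invol

theorem IsPairing.mono {G' : SimpleGraph V} (hm : IsPairing G m) (h : G ≤ G') : IsPairing G' m :=
  ⟨hm.invol, fun v hv => h (hm.adj v hv)⟩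

theorem isPairing_id (G : SimpleGraph V) : IsPairing G id := ⟨fun _ => rfl, fun _ h => (h rfl).elim⟩

theorem exists_isMaxPairing [Finite V] (G : SimpleGraph V) : ∃ m, IsMaxPairing G m := by
  obtain ⟨m, hm, h⟩ := Set.exists_min_image {m | IsPairing G m} (fun m => (fixedPoints m).ncard)
    (Set.toFinite _) ⟨id, isPairing_id G⟩
  exact ⟨m, hm, h⟩

theorem IsMaxPairing.ncard_eq {m' : V → V} (hm : IsMaxPairing G m) (hm' : IsMaxPairing G m') :
    (fixedPoints m).ncard = (fixedPoints m').ncard :=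
  le_antisymm (hm.2 _ hm'.1) (hm'.2 _ hm.1)

theorem IsMaxPairing.of_ncard_le {m' : V → V} (hm : IsMaxPairing G m) (hm' : IsPairing G m')
    (h : (fixedPoints m').ncard ≤ (fixedPoints m).ncard) : IsMaxPairing G m' :=
  ⟨hm', fun _ h' => h.trans (hm.2 _ h')⟩

theorem ncard_compl_fixedPoints_le [Finite V] {m' : V → V} (hm : IsMaxPairing G m)
    (hm' : IsPairing G m') : (fixedPoints m')ᶜ.ncard ≤ (fixedPoints m)ᶜ.ncard := by
  have h1 := Set.ncard_add_ncard_compl (fixedPoints m)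
  have h2 := Set.ncard_add_ncard_compl (fixedPoints m')
  have h3 := hm.2 _ hm'
  omega

theorem isMaxPairing_of_ncard_compl_le [Finite V] {m' : V → V} (hm : IsMaxPairing G m)
    (hm' : IsPairing G m') (h : (fixedPoints m)ᶜ.ncard ≤ (fixedPoints m')ᶜ.ncard) :
    IsMaxPairing G m' := by
  have h1 := Set.ncard_add_ncard_compl (fixedPoints m)
  have h2 := Set.ncard_add_ncard_compl (fixedPoints m')
  exact hm.of_ncard_le hm' (by omega)

/-- Moving an unsaturated vertex `r` along the edges `r (m y)` and `(m y) y`. -/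
theorem IsMaxPairing.conj_swap [DecidableEq V] [Finite V] (hm : IsMaxPairing G m) {r y : V}
    (hr : m r = r) (hy : G.Adj r (m y)) :
    IsMaxPairing G (fun v => Equiv.swap r y (m (Equiv.swap r y v))) := by
  have hinv := hm.1.invol
  have hyy : m (m y) = y := hinv y
  refine hm.of_ncard_le ⟨fun v => by simp [hinv], fun v hv => ?_⟩ ?_
  · by_cases h1 : v = r
    · subst h1
      have : m y ≠ y := by
        rintro h; simp [h] at hv
      have h2 : m y ≠ v := hy.ne'
      simpa [Equiv.swap_apply_of_ne_of_ne h2 this] using hy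
    · by_cases h2 : v = y
      · subst h2; simp [hr] at hv
      · rw [Equiv.swap_apply_of_ne_of_ne h1 h2] at hv ⊢
        by_cases h3 : m v = y
        · have h4 : v = m y := by rw [← h3, hinv]
          rw [h3, Equiv.swap_apply_right, h4]
          exact hy.symm
        · have h4 : m v ≠ r := fun h => h1 (by rw [← hinv v, h, hr])
          rw [Equiv.swap_apply_of_ne_of_ne h4 h3] at hv ⊢
          exact hm.1.adj v hv
  -- Conjugation by a transposition carries fixed points to fixed points bijectively, so maximality
  -- is kept.
  · have : fixedPoints (fun v => Equiv.swap r y (m (Equiv.swap r y v))) =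
        Equiv.swap r y '' fixedPoints m := by
      ext v
      rw [Equiv.image_eq_preimage_symm]
      simp only [mem_fixedPoints, IsFixedPt, Set.mem_preimage, Equiv.symm_swap]
      constructor
      · intro h
        simpa using congrArg (Equiv.swap r y) h
      · intro h; rw [h]; simp
    rw [this, Set.ncard_image_of_injective _ (Equiv.injective _)]

/-! ### Pairings and matchings -/

/-- The matching with the same edges. -/
def IsPairing.toSubgraph (hm : IsPairing G m) : G.Subgraph where
  verts := (fixedPoints m)ᶜ
  Adj v w := m v = w ∧ m v ≠ v
  adj_sub := by
    rintro v w ⟨rfl, h⟩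
    exact hm.adj v h
  edge_vert := fun h => h.2
  symm := ⟨by
    rintro v w ⟨rfl, h⟩
    exact ⟨hm.invol v, by rw [hm.invol]; exact h.symm⟩⟩

theorem IsPairing.isMatching_toSubgraph (hm : IsPairing G m) : hm.toSubgraph.IsMatching :=
  fun v hv => ⟨m v, ⟨rfl, hv⟩, fun _ h => h.1.symm⟩

theorem exists_isPairing_of_isMatching {M : G.Subgraph} (hM : M.IsMatching) :
    ∃ m, IsPairing G m ∧ (∀ v, m v = v ↔ v ∉ M.verts) ∧ ∀ v w, M.Adj v w ↔ m v = w ∧ v ≠ w := by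
  classical
  choose g hg using fun v (h : v ∈ M.verts) => (hM h).exists
  let m : V → V := fun v => if h : v ∈ M.verts then g v h else v
  have hadj : ∀ v w, M.Adj v w → m v = w := by
    intro v w h
    have hv := M.edge_vert h
    simp only [m, hv, dif_pos]
    exact (hM hv).unique (hg v hv) h
  have hmem : ∀ v ∈ M.verts, M.Adj v (m v) := by
    intro v hv
    simp only [m, hv, dif_pos]
    exact hg v hv
  have hnot : ∀ v, v ∉ M.verts → m v = v := fun v hv => by simp [m, hv]
  refine ⟨m, ⟨fun v => ?_, fun v hv => ?_⟩, fun v => ⟨fun h hv => ?_, hnot v⟩, fun v w =>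
    ⟨fun h => ⟨hadj v w h, h.ne⟩, ?_⟩⟩
  · by_cases hv : v ∈ M.verts
    · exact hadj _ _ (hmem v hv).symm
    · rw [hnot v hv, hnot v hv]
  · by_cases h : v ∈ M.verts
    · exact (hmem v h).adj_sub
    · exact (hv (hnot v h)).elim
  · exact (hmem v hv).ne h.symm
  · rintro ⟨rfl, h⟩
    by_cases hv : v ∈ M.verts
    · exact hmem v hv
    · exact (h (hnot v hv).symm).elim

/-- In a subgraph all of whose vertices have degree `d`, there are `d * |V|` incidences. -/
theorem ncard_verts_mul_of_degree [Finite V] (M : G.Subgraph) (d : ℕ)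
    (h : ∀ v ∈ M.verts, (M.neighborSet v).ncard = d) :
    M.verts.ncard * d = 2 * M.edgeSet.ncard := by
  classical
  have := Fintype.ofFinite V
  have h1 := M.spanningCoe.sum_degrees_eq_twice_card_edges
  have h2 : ∀ v, M.spanningCoe.degree v = if v ∈ M.verts then d else 0 := by
    intro v
    rw [← SimpleGraph.card_neighborSet_eq_degree, ← Nat.card_eq_fintype_card]
    have : M.spanningCoe.neighborSet v = M.neighborSet v := rfl
    rw [this, Nat.card_coe_set_eq]
    split_ifs with hv
    · exact h v hv
    · rw [Set.ncard_eq_zero]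
      ext w
      simp only [Subgraph.mem_neighborSet, Set.mem_empty_iff_false, iff_false]
      exact fun hw => hv (M.edge_vert hw)
  simp only [h2, Finset.sum_ite, Finset.sum_const_zero, Finset.sum_const, add_zero] at h1
  rw [Set.ncard_eq_toFinset_card', Set.ncard_eq_toFinset_card']
  rw [smul_eq_mul] at h1
  convert h1 using 3
  · ext; simp
  · ext e; simp

theorem ncard_verts_of_isMatching [Finite V] {M : G.Subgraph} (hM : M.IsMatching) :
    M.verts.ncard = 2 * M.edgeSet.ncard := by
  rw [← ncard_verts_mul_of_degree M 1, mul_one]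
  intro v hv
  obtain ⟨w, hw, hu⟩ := hM hv
  rw [Set.ncard_eq_one]
  exact ⟨w, Set.eq_singleton_iff_unique_mem.2 ⟨hw, hu⟩⟩

/-- The fixed points number |V| - 2|E(M)|, so fewest fixed points means most edges. -/
theorem isMaximumMatching_iff [Finite V] {M : G.Subgraph} (hM : M.IsMatching)
    (hm : IsPairing G m) (h : ∀ v, m v = v ↔ v ∉ M.verts) :
    IsMaximumMatching G M ↔ IsMaxPairing G m := by
  have key : ∀ {M : G.Subgraph} {m : V → V}, M.IsMatching → (∀ v, m v = v ↔ v ∉ M.verts) →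
      (fixedPoints m).ncard + 2 * M.edgeSet.ncard = Nat.card V := by
    intro M m hM h
    rw [← ncard_verts_of_isMatching hM, ← Set.ncard_add_ncard_compl (fixedPoints m)]
    congr 2
    ext v
    simp [IsFixedPt, h]
  have hk := key hM h
  constructor
  · refine fun hmax => ⟨hm, fun m' hm' => ?_⟩
    have h1 := hmax.2 _ hm'.isMatching_toSubgraph
    have h2 := key hm'.isMatching_toSubgraph (m := m')
      (fun v => by simp [IsPairing.toSubgraph, IsFixedPt])
    omega
  · refine fun hmax => ⟨hM, fun M' hM' => ?_⟩
    obtain ⟨m', hm', h', -⟩ := exists_isPairing_of_isMatching hM'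
    have h1 := hmax.2 _ hm'
    have h2 := key hM' h'
    omega

theorem mem_geD_iff [Finite V] {v : V} : v ∈ geD G ↔ ∃ m, IsMaxPairing G m ∧ m v = v := by
  constructor
  · rintro ⟨M, hM, hv⟩
    obtain ⟨m, hm, h, -⟩ := exists_isPairing_of_isMatching hM.1
    exact ⟨m, (isMaximumMatching_iff hM.1 hm h).1 hM, (h v).2 hv⟩
  · rintro ⟨m, hm, hv⟩
    refine ⟨hm.1.toSubgraph, (isMaximumMatching_iff hm.1.isMatching_toSubgraph hm.1
      (fun v => ?_)).2 hm, ?_⟩ <;> simp [IsPairing.toSubgraph, IsFixedPt, hv]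

end Pairing

/-! ### König duality and the Gallai–Edmonds sets of bipartite graphs -/

section Konig

variable {V : Type*} {G : SimpleGraph V}

/-- Weak duality: each matching edge uses up a vertex of the cover. Equality fails if a cover vertex
is wasted, either unsaturated or matched to another cover vertex; `m k ∈ K` expresses both cases at
once. -/
theorem ncard_compl_fixedPoints_le_of_isVertexCover [Finite V] {K : Set V} {m : V → V}
    (hK : G.IsVertexCover K) (hm : IsPairing G m) : (fixedPoints m)ᶜ.ncard ≤ 2 * K.ncard ∧
      ((∃ k ∈ K, m k ∈ K) → (fixedPoints m)ᶜ.ncard + 2 ≤ 2 * K.ncard) := by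
  set K1 : Set V := {k | k ∈ K ∧ m k ∉ K} with hK1
  set K2 : Set V := {k | k ∈ K ∧ m k ∈ K} with hK2
  have hsum : K1.ncard + K2.ncard = K.ncard := by
    rw [← Set.ncard_union_eq]
    · congr 1
      ext v
      simp only [hK1, hK2, Set.mem_union, Set.mem_ofPred_eq]
      tauto
    · rw [Set.disjoint_left]
      rintro v ⟨_, h⟩ ⟨_, h'⟩
      exact h h'
  have hsub : (fixedPoints m)ᶜ ⊆ K1 ∪ m '' K1 ∪ (K2 \ fixedPoints m) := by
    intro v hv
    have hadj := hm.adj v hv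
    by_cases h1 : v ∈ K
    · by_cases h2 : m v ∈ K
      · exact Or.inr ⟨⟨h1, h2⟩, hv⟩
      · exact Or.inl (Or.inl ⟨h1, h2⟩)
    · have h2 : m v ∈ K := (hK hadj).resolve_left h1
      exact Or.inl (Or.inr ⟨m v, ⟨h2, by rwa [hm.invol]⟩, hm.invol v⟩)
  have hle : (fixedPoints m)ᶜ.ncard ≤ 2 * K1.ncard + (K2 \ fixedPoints m).ncard := by
    have h1 := Set.ncard_le_ncard hsub
    have h2 := Set.ncard_union_le (K1 ∪ m '' K1) (K2 \ fixedPoints m)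
    have h3 := Set.ncard_union_le K1 (m '' K1)
    have h4 := Set.ncard_image_le (f := m) (s := K1)
    omega
  have hle2 : (K2 \ fixedPoints m).ncard ≤ K2.ncard := Set.ncard_le_ncard Set.sdiff_subset
  refine ⟨by omega, ?_⟩
  rintro ⟨k, hk, hmk⟩
  by_cases hfix : m k = k
  · have : (K2 \ fixedPoints m).ncard < K2.ncard :=
      Set.ncard_lt_ncard ⟨Set.sdiff_subset, fun h => (h (show k ∈ K2 from ⟨hk, hmk⟩)).2 hfix⟩
    omega
  · have : 2 ≤ K2.ncard := by
      rw [← Set.ncard_pair (Ne.symm hfix)]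
      refine Set.ncard_le_ncard ?_
      rintro v (rfl | rfl)
      · exact ⟨hk, hmk⟩
      · exact ⟨hmk, by rwa [hm.invol]⟩
    omega

theorem two_mul_ncard_le_of_forall_notMem [Finite V] {K : Set V} {m : V → V}
    (hm : IsPairing G m) (h : ∀ k ∈ K, m k ∉ K) : 2 * K.ncard ≤ (fixedPoints m)ᶜ.ncard := by
  have h1 : (K ∪ m '' K).ncard = K.ncard + K.ncard := by
    rw [Set.ncard_union_eq, Set.ncard_image_of_injective _ hm.injective]
    rw [Set.disjoint_left]
    rintro _ hv ⟨k, hk, rfl⟩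
    exact h k hk hv
  rw [two_mul, ← h1]
  refine Set.ncard_le_ncard ?_
  rintro v (hv | ⟨k, hk, rfl⟩) hfix
  · exact h v hv (by rwa [show m v = v from hfix])
  · have : m (m k) = m k := hfix
    rw [hm.invol] at this
    exact h k hk (by rwa [← this])

/-- A minimum vertex cover of a bipartite graph is matched into its complement. -/
theorem exists_isVertexCover_isPairing [Finite V] (hG : G.IsBipartite) :
    ∃ (K : Set V) (m : V → V), G.IsVertexCover K ∧ IsPairing G m ∧ ∀ k ∈ K, m k ∉ K := by
  classical
  have := Fintype.ofFinite V
  obtain ⟨c⟩ := hG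
  obtain ⟨K, hK, hmin⟩ := Set.exists_min_image {K : Set V | G.IsVertexCover K} Set.ncard
    (Set.toFinite _) ⟨Set.univ, isVertexCover_univ⟩
  have hall : ∀ s : Fin 2, ∃ g : {v // v ∈ K ∧ c v = s} → V, Injective g ∧
      ∀ v : {v // v ∈ K ∧ c v = s}, g v ∈ Finset.univ.filter fun w => w ∉ K ∧ G.Adj v w := by
    intro s
    refine (Finset.all_card_le_biUnion_card_iff_exists_injective _).1 fun S => ?_
    -- If Hall's condition fails for `S`, trading `S` for its neighbours `T` outside `K` gives a
    -- smaller cover. No edge inside `S` is lost, since `S` lies in one colour class.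
    by_contra! hlt
    set T : Finset V := S.biUnion fun v => Finset.univ.filter fun w => w ∉ K ∧ G.Adj v w with hT
    set S' : Finset V := S.image Subtype.val with hS'
    have hS'card : S'.card = S.card := Finset.card_image_of_injective _ Subtype.val_injective
    have hS'K : (S' : Set V) ⊆ K := by
      intro v hv
      obtain ⟨⟨w, hw⟩, -, rfl⟩ := Finset.mem_image.1 (Finset.mem_coe.1 hv)
      exact hw.1
    have hS'c : ∀ v ∈ S', c v = s := by
      intro v hv
      obtain ⟨⟨w, hw⟩, -, rfl⟩ := Finset.mem_image.1 hv
      exact hw.2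
    have key : ∀ u v, G.Adj u v → u ∈ K → u ∈ K \ S' ∪ T ∨ v ∈ K \ S' ∪ T := by
      intro u v huv hu
      by_cases hu' : u ∈ S'
      · right
        by_cases hv : v ∈ K
        · exact Or.inl ⟨hv, fun h => c.valid huv (by rw [hS'c u hu', hS'c v h])⟩
        · obtain ⟨w, hw, rfl⟩ := Finset.mem_image.1 hu'
          exact Or.inr (Finset.mem_coe.2 (Finset.mem_biUnion.2 ⟨w, hw, by simp [hv, huv]⟩))
      · exact Or.inl (Or.inl ⟨hu, hu'⟩)
    have hcov : G.IsVertexCover (K \ S' ∪ T) := fun u v huv =>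
      (hK huv).elim (key u v huv) fun h => (key v u huv.symm h).symm
    have h1 := hmin _ hcov
    have h2 := Set.ncard_union_le (K \ S') (T : Set V)
    have h3 := Set.ncard_sdiff_add_ncard_of_subset hS'K
    rw [Set.ncard_coe_finset] at h2 h3
    omega
  choose g hinj hg using hall
  simp only [Finset.mem_filter, Finset.mem_univ, true_and] at hg
  let f : K → V := fun v => g (c v) ⟨v, v.2, rfl⟩
  have hfK : ∀ v, f v ∉ K := fun v => (hg _ _).1
  have hfa : ∀ v : K, G.Adj v (f v) := fun v => (hg _ ⟨v.1, v.2, rfl⟩).2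
  have hfinj : Injective f := by
    intro v w hvw
    have h1 := c.valid (hfa v)
    have h2 := c.valid (hfa w)
    rw [← hvw] at h2
    -- With only two colours, vertices sharing an image have the same colour, so injectivity within
    -- a class suffices.
    have h3 : c v = c w := by omega
    have : ∀ s (h : c v = s) (h' : c w = s), g s ⟨v, v.2, h⟩ = g s ⟨w, w.2, h'⟩ → v = w := by
      intro s h h' hh
      have := hinj s hh
      simpa [Subtype.ext_iff] using this
    have hfs : ∀ (v : K) s (h : c v = s), g s ⟨v, v.2, h⟩ = f v := by
      rintro v _ rfl; rfl
    exact this (c w) h3 rfl ((hfs v _ h3).trans hvw)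
  let m : V → V := fun v => if h : v ∈ K then f ⟨v, h⟩ else
    if h : ∃ k, f k = v then (h.choose : V) else v
  have hmK : ∀ k : K, m k = f k := fun k => by simp [m]
  have hmf : ∀ k : K, m (f k) = k := by
    intro k
    have h : ∃ k', f k' = f k := ⟨k, rfl⟩
    simp only [m, hfK, dif_neg, not_false_eq_true, h, dif_pos]
    rw [hfinj h.choose_spec]
  have hmo : ∀ v, v ∉ K → (¬ ∃ k, f k = v) → m v = v := fun v h h' => by
    simp only [m, h, h', dif_neg, not_false_eq_true]
  refine ⟨K, m, hK, ⟨fun v => ?_, fun v hv => ?_⟩, fun k hk => ?_⟩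
  · by_cases h : v ∈ K
    · rw [hmK ⟨v, h⟩, hmf]
    · by_cases h' : ∃ k, f k = v
      · obtain ⟨k, rfl⟩ := h'
        rw [hmf, hmK]
      · rw [hmo v h h', hmo v h h']
  · by_cases h : v ∈ K
    · rw [hmK ⟨v, h⟩]; exact hfa ⟨v, h⟩
    · by_cases h' : ∃ k, f k = v
      · obtain ⟨k, rfl⟩ := h'
        rw [hmf]; exact (hfa k).symm
      · exact (hv (hmo v h h')).elim
  · rw [hmK ⟨k, hk⟩]; exact hfK _

/-- The vertices missed by maximum matchings of a bipartite graph are independent. -/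
theorem not_adj_of_mem_geD [Finite V] (hG : G.IsBipartite) {u v : V} (hu : u ∈ geD G)
    (hv : v ∈ geD G) : ¬ G.Adj u v := by
  intro huv
  obtain ⟨K, m₀, hK, hm₀, ht⟩ := exists_isVertexCover_isPairing hG
  have h1 := two_mul_ncard_le_of_forall_notMem hm₀ ht
  have key : ∀ w ∈ geD G, w ∉ K := by
    intro w hw hwK
    obtain ⟨m, hm, hmw⟩ := mem_geD_iff.1 hw
    have h2 := ncard_compl_fixedPoints_le hm hm₀
    have h3 := (ncard_compl_fixedPoints_le_of_isVertexCover hK hm.1).2 ⟨w, hwK, by rwa [hmw]⟩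
    omega
  exact (hK huv).elim (key u hu) (key v hv)

/-- Maximum matchings of a bipartite graph match `A(G)` into `D(G)`. -/
theorem apply_mem_geD_of_isBipartite [Finite V] (hG : G.IsBipartite) {m : V → V}
    (hm : IsMaxPairing G m) {a : V} (ha : a ∈ geA G) : m a ∈ geD G := by
  by_contra hu
  set u := m a with hmu
  obtain ⟨hau, d, hd, hda⟩ := ha
  -- Since `u` is never missed, isolating it lowers the matching number. A minimum cover `K` of `G'`
  -- together with `u` is then a cover tight for every maximum matching of `G`. It omits the
  -- missable `d`, so it contains `a`; but then the edge from `a` to `u` has both ends in it.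
  let G' : SimpleGraph V := G.deleteEdges {e | u ∈ e}
  have hle : G' ≤ G := deleteEdges_le _
  obtain ⟨K, m₀, hK, hm₀, ht⟩ := exists_isVertexCover_isPairing (G := G') (hG.mono_left hle)
  have hm₀u : m₀ u = u := by
    by_contra h
    have := hm₀.adj u h
    simp [G'] at this
  have hcov : G.IsVertexCover (insert u K) := by
    intro v w hvw
    by_cases hv : v = u
    · exact Or.inl (Or.inl hv)
    by_cases hw : w = u
    · exact Or.inr (Or.inl hw)
    have : G'.Adj v w := by simp [G', hvw, Ne.symm hv, Ne.symm hw]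
    exact (hK this).imp Or.inr Or.inr
  have hcard : (insert u K).ncard ≤ K.ncard + 1 := Set.ncard_insert_le _ _
  have h1 := two_mul_ncard_le_of_forall_notMem hm₀ ht
  have hlt : (fixedPoints m₀)ᶜ.ncard < (fixedPoints m)ᶜ.ncard := by
    by_contra! h
    exact hu (mem_geD_iff.2 ⟨m₀, isMaxPairing_of_ncard_compl_le hm (hm₀.mono hle) h, hm₀u⟩)
  have key : ∀ m', IsMaxPairing G m' → ∀ k ∈ insert u K, m' k ∉ insert u K := by
    intro m' hm' k hk hmk
    have h2 := (ncard_compl_fixedPoints_le_of_isVertexCover hcov hm'.1).2 ⟨k, hk, hmk⟩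
    have h3 := ncard_compl_fixedPoints_le hm' hm.1
    omega
  obtain ⟨m', hm', hmd⟩ := mem_geD_iff.1 hd
  have hdK : d ∉ insert u K := fun h => key m' hm' d h (by rwa [hmd])
  have haK := (hcov hda).resolve_left hdK
  exact key m hm a haK (Or.inl rfl)

end Konig

/-! ### Odd cycles and bipartiteness -/

section OddCycle

variable {V : Type*} {G : SimpleGraph V}

/-- A walk can be shortened to a path of the same parity, unless there is an odd cycle. -/
theorem exists_isPath_or_isOddCycle {u v : V} (p : G.Walk u v) :
    (∃ q : G.Walk u v, q.IsPath ∧ (Even q.length ↔ Even p.length)) ∨ ∃ C, IsOddCycle G C := by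
  classical
  induction p with
  | nil => exact Or.inl ⟨Walk.nil, Walk.IsPath.nil, Iff.rfl⟩
  | @cons u w v h p ih =>
    obtain ⟨q, hq, hpar⟩ | hC := ih
    swap
    · exact Or.inr hC
    by_cases hu : u ∈ q.support
    · set t := q.takeUntil u hu with ht
      have htp : t.IsPath := hq.takeUntil hu
      have hlen : q.length = t.length + (q.dropUntil u hu).length := by
        conv_lhs => rw [← q.take_spec hu]
        rw [Walk.length_append]
      -- If the initial segment is even, the new edge closes it to an odd cycle. If it is odd,
      -- cutting out this segment and the new edge preserves parity.
      by_cases hev : Even t.length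
      · right
        have hcyc : (Walk.cons h t).IsCycle := by
          rw [Walk.cons_isCycle_iff]
          refine ⟨htp, fun hmem => ?_⟩
          rw [Sym2.eq_swap] at hmem
          rw [htp.length_eq_one_of_mem_edges hmem] at hev
          exact absurd hev (by decide)
        exact ⟨_, u, _, hcyc, by simpa [Nat.odd_add_one] using hev, rfl⟩
      · left
        refine ⟨q.dropUntil u hu, hq.dropUntil hu, ?_⟩
        rw [Walk.length_cons, Nat.even_add_one, ← hpar, hlen, Nat.even_add]
        tauto
    · left
      refine ⟨Walk.cons h q, hq.cons hu, ?_⟩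
      simp only [Walk.length_cons, Nat.even_add_one, hpar]

theorem isBipartite_of_forall_not_isOddCycle (h : ∀ C, ¬ IsOddCycle G C) : G.IsBipartite := by
  refine two_colorable_iff_forall_loop_even.2 fun u w => ?_
  obtain ⟨q, hq, hpar⟩ | ⟨C, hC⟩ := exists_isPath_or_isOddCycle w
  · rw [← hpar, Walk.length_eq_zero_iff.2 (Walk.isPath_iff_nil.1 hq)]
    exact Even.zero
  · exact (h C hC).elim

/-- Deleting an edge of the only odd cycle leaves a bipartite graph. -/
theorem isBipartite_deleteEdges {C : G.Subgraph} (hC : ∀ C', IsOddCycle G C' → C' = C) {x y : V}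
    (hxy : C.Adj x y) : (G.deleteEdges {s(x, y)}).IsBipartite := by
  refine isBipartite_of_forall_not_isOddCycle ?_
  rintro _ ⟨u, p, hp, hodd, -⟩
  have hle : G.deleteEdges {s(x, y)} ≤ G := deleteEdges_le _
  have h1 := hC _ ⟨u, p.mapLe hle, hp.mapLe hle, by simpa using hodd, rfl⟩
  have h2 : s(x, y) ∈ C.edgeSet := hxy
  rw [← h1, Walk.mem_edges_toSubgraph, Walk.edges_mapLe_eq_edges] at h2
  have := p.edges_subset_edgeSet h2
  simp at this

/-- A cyclic enumeration of the vertices of an odd cycle. -/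
theorem IsOddCycle.exists_enumeration {C : G.Subgraph} (hC : IsOddCycle G C) :
    ∃ (n : ℕ) (f : ℕ → V), Odd n ∧ C.verts = Set.range f ∧ (∀ i, f (i + n) = f i) ∧
      (∀ i, C.Adj (f i) (f (i + 1))) ∧ (∀ i, f i ≠ f (i + 2)) ∧
      ∀ i z, C.Adj (f (i + 1)) z → z = f i ∨ z = f (i + 2) := by
  obtain ⟨u, p, hp, hodd, rfl⟩ := hC
  have h3 := hp.three_le_length
  set n := p.length with hn
  let f : ℕ → V := fun i => p.getVert (i % n)
  have hlt : ∀ i, i % n < n := fun i => Nat.mod_lt _ (by omega)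
  have hsucc : ∀ i, (i + 1) % n = if i % n + 1 = n then 0 else i % n + 1 := by
    intro i
    rw [Nat.add_mod, Nat.mod_eq_of_lt (show 1 < n by omega)]
    split_ifs with h
    · rw [h, Nat.mod_self]
    · exact Nat.mod_eq_of_lt (by have := hlt i; omega)
  have hadj : ∀ i, p.toSubgraph.Adj (f i) (f (i + 1)) := by
    intro i
    have h1 := p.toSubgraph_adj_getVert (hlt i)
    have h2 : p.getVert ((i + 1) % n) = p.getVert (i % n + 1) := by
      rw [hsucc]
      split_ifs with h
      · rw [h, hn, Walk.getVert_length, Walk.getVert_zero]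
      · rfl
    simp only [f, h2]
    exact h1
  have hne : ∀ i, f i ≠ f (i + 2) := by
    intro i h
    have h1 := hp.getVert_injOn' (show i % n ≤ p.length - 1 by have := hlt i; omega)
      (show (i + 2) % n ≤ p.length - 1 by have := hlt (i + 2); omega) h
    have h2 := hsucc i
    have h4 := hsucc (i + 1)
    have := hlt i
    rw [h2] at h4
    rw [show i + 2 = i + 1 + 1 from rfl, h4] at h1
    split_ifs at h1 <;> omega
  have hrange : p.toSubgraph.verts = Set.range f := by
    ext v
    rw [Walk.mem_verts_toSubgraph, Walk.mem_support_iff_exists_getVert]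
    constructor
    · rintro ⟨i, rfl, hi⟩
      rcases hi.lt_or_eq with hi | rfl
      · exact ⟨i, by simp only [f]; rw [Nat.mod_eq_of_lt hi]⟩
      · exact ⟨0, by simp [f]⟩
    · rintro ⟨i, rfl⟩
      exact ⟨i % n, rfl, (hlt i).le⟩
  refine ⟨n, f, hodd, hrange, fun i => by simp [f], hadj, hne, fun i z hz => ?_⟩
  have hmem : f (i + 1) ∈ p.support := by
    rw [← Walk.mem_verts_toSubgraph, hrange]; exact ⟨_, rfl⟩
  have h2 := hp.ncard_neighborSet_toSubgraph_eq_two hmem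
  have hsub : ({f i, f (i + 2)} : Set V) ⊆ p.toSubgraph.neighborSet (f (i + 1)) := by
    rintro v (rfl | rfl)
    · exact (hadj i).symm
    · exact hadj (i + 1)
  have := Set.eq_of_subset_of_ncard_le hsub (by rw [h2, Set.ncard_pair (hne i)])
    (Set.finite_of_ncard_ne_zero (by omega))
  have hz' : z ∈ p.toSubgraph.neighborSet (f (i + 1)) := hz
  rw [← this] at hz'
  exact hz'

/-- Two matchings do not cover the edges of an odd cycle. -/
theorem IsOddCycle.exists_adj_notMem {C : G.Subgraph} (hC : IsOddCycle G C) {m m' : V → V}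
    (hm : ∀ v, m (m v) = v) (hm' : ∀ v, m' (m' v) = v) :
    ∃ x y, C.Adj x y ∧ m x ≠ y ∧ m' x ≠ y := by
  obtain ⟨n, f, ⟨k, hk⟩, -, hper, hadj, hne, -⟩ := hC.exists_enumeration
  by_contra! hcon
  -- If the matchings covered the cycle they would alternate along it. After 2k + 1 edges `m` would
  -- contain both cycle edges at `f 0`.
  have step : ∀ {m m' : V → V}, (∀ v, m (m v) = v) → (∀ v, m' (m' v) = v) →
      (∀ i, m (f i) ≠ f (i + 1) → m' (f i) = f (i + 1)) → m (f 0) = f 1 → False := by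
    intro m m' hm hm' h h0
    have next : ∀ {m : V → V}, (∀ v, m (m v) = v) → ∀ i, m (f i) = f (i + 1) →
        m (f (i + 1)) ≠ f (i + 2) := by
      intro m hm i h1 h2
      rw [← h1, hm] at h2
      exact hne i h2
    have hall : ∀ j, m (f (2 * j)) = f (2 * j + 1) := by
      intro j
      induction j with
      | zero => exact h0
      | succ j ih =>
        by_contra h4
        exact next hm' (2 * j + 1) (h _ (next hm _ ih)) (h _ h4)
    have h1 := hall k
    rw [← hk, show n = 0 + n by omega, hper] at h1
    have h2 : m (f 0) = f (2 * k) := by rw [← h1, hm]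
    have h4 := hne (2 * k)
    rw [show 2 * k + 2 = 1 + n by omega, hper] at h4
    exact h4 (h2.symm.trans h0)
  by_cases h0 : m (f 0) = f 1
  · exact step hm hm' (fun i => hcon _ _ (hadj i)) h0
  · refine step hm' hm (fun i hi => ?_) (hcon _ _ (hadj 0) h0)
    by_contra h
    exact hi (hcon _ _ (hadj i) h)

end OddCycle

/-! ### Flowers and the structure of the odd pieces -/

section OddPiece

variable {V : Type*} {G : SimpleGraph V}

/-- Switching an alternating path of even length that starts at an unsaturated vertex. -/
theorem exists_isMaxPairing_of_isAlternatingWalk [Finite V] {M : G.Subgraph} {m₀ : V → V}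
    (hM : ∀ v w, M.Adj v w → m₀ v = w) {r b : V} (n : ℕ) (w : G.Walk r b) (hn : w.length = 2 * n)
    (m : V → V) (hm : IsMaxPairing G m) (hmr : m r = r) (hpath : w.IsPath)
    (halt : IsAlternatingWalk G M w) (hfst : ∀ e ∈ w.edges.head?, e ∉ M.edgeSet)
    (hagree : ∀ y ∈ w.support, y ≠ r → m y = m₀ y) :
    (∀ y ∈ w.support, y ∈ geD G ∨ ∃ u ∈ geD G, G.Adj u y) ∧
      ∃ m', IsMaxPairing G m' ∧ m' b = b ∧ ∀ z, z ∉ w.support → m' z = m z := by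
  classical
  -- Two edges of the path are switched at a time. The matching changes while alternation refers to
  -- the original `M`; `hagree` records that the remaining path is still untouched beyond its start.
  induction n generalizing r m with
  | zero =>
    cases w with
    | nil =>
      refine ⟨fun y hy => Or.inl (mem_geD_iff.2 ⟨m, hm, ?_⟩), m, hm, hmr, fun _ _ => rfl⟩
      rw [Walk.support_nil, List.mem_singleton] at hy
      rwa [hy]
    | cons h w => simp at hn
  | succ n ih =>
    match r, w, hn, hmr, hpath, halt, hfst, hagree with
    | _, .nil, hn, _, _, _, _, _ => simp at hn
    | _, .cons h .nil, hn, _, _, _, _, _ => simp at hn; omega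
    | r, .cons (v := x) h (.cons (v := y) h' w), hn, hmr, hpath, halt, hfst, hagree =>
      rw [Walk.cons_isPath_iff, Walk.cons_isPath_iff] at hpath
      obtain ⟨⟨hw, hx⟩, hr⟩ := hpath
      rw [Walk.support_cons, List.mem_cons, not_or] at hr
      unfold IsAlternatingWalk at halt
      rw [Walk.edges_cons, Walk.edges_cons, List.isChain_cons_cons] at halt
      have hrx : s(r, x) ∉ M.edgeSet := hfst _ (by simp)
      have hxy : s(x, y) ∈ M.edgeSet := by
        rcases halt.1 with h1 | h1
        · exact (hrx h1.1).elim
        · exact h1.1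
      have hmx : m x = y := by
        rw [hagree x (by simp) (Ne.symm hr.1)]
        exact hM _ _ hxy
      have hmy : m y = x := by rw [← hmx, hm.1.invol]
      have hyw : y ∈ w.support := w.start_mem_support
      have hm' := hm.conj_swap hmr (y := y) (by rwa [hmy])
      set m' : V → V := fun v => Equiv.swap r y (m (Equiv.swap r y v)) with hm'def
      have hm'y : m' y = y := by simp [m', hmr]
      have hm'o : ∀ v, v ≠ r → v ≠ y → v ≠ x → m' v = m v := by
        intro v h1 h2 h3
        simp only [m', Equiv.swap_apply_of_ne_of_ne h1 h2]
        refine Equiv.swap_apply_of_ne_of_ne (fun h4 => h1 ?_) (fun h4 => h3 ?_)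
        · rw [← hm.1.invol v, h4, hmr]
        · rw [← hm.1.invol v, h4, hmy]
      have hlen : w.length = 2 * n := by simp at hn; omega
      obtain ⟨h1, m'', hm'', hb, ho⟩ := ih w hlen m' hm' hm'y hw halt.2.of_cons (by
          intro e he
          have := halt.2
          cases hw' : w.edges with
          | nil => simp [hw'] at he
          | cons e' l =>
            rw [hw', List.isChain_cons_cons] at this
            have he' : e' = e := by simpa [hw'] using he
            rcases this.1 with h1 | h1
            · rw [← he']; exact h1.2
            · exact (h1.2 hxy).elim) (by
          intro z hz hzy
          rw [hm'o z (fun h => hr.2 ?_) hzy (fun h => hx (h ▸ hz))]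
          · refine hagree z (by simp [hz]) (fun h => hr.2 ?_)
            simp [← h, hz]
          · simp [← h, hz])
      have hrD : r ∈ geD G := mem_geD_iff.2 ⟨m, hm, hmr⟩
      refine ⟨fun z hz => ?_, m'', hm'', hb, fun z hz => ?_⟩
      · simp only [Walk.support_cons, List.mem_cons] at hz
        rcases hz with rfl | rfl | hz
        · exact Or.inl hrD
        · exact Or.inr ⟨r, hrD, h⟩
        · exact h1 z hz
      · simp only [Walk.support_cons, List.mem_cons, not_or] at hz
        rw [ho z hz.2.2, hm'o z hz.1 (fun h => hz.2.2 (h ▸ hyw)) hz.2.1]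

/-- `m` is a maximum matching that misses `b ∈ C` and matches the other vertices of `C` along
edges of `C`. -/
structure IsNearPerfectOn (G : SimpleGraph V) (C : G.Subgraph) (m : V → V) (b : V) : Prop where
  max : IsMaxPairing G m
  mem : b ∈ C.verts
  fix : m b = b
  adj : ∀ z ∈ C.verts, z ≠ b → C.Adj z (m z)

theorem IsOddCycle.ncard_verts [Finite V] {C : G.Subgraph} (hC : IsOddCycle G C) :
    C.verts.ncard = C.edgeSet.ncard := by
  obtain ⟨u, p, hp, -, rfl⟩ := hC
  have := ncard_verts_mul_of_degree p.toSubgraph 2 fun v hv =>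
    hp.ncard_neighborSet_toSubgraph_eq_two ((Walk.mem_verts_toSubgraph p).1 hv)
  omega

theorem IsBlossom.odd_ncard_verts [Finite V] {M C : G.Subgraph} (h : IsBlossom G M C) :
    Odd C.verts.ncard := by
  rw [h.1.ncard_verts, h.2]
  exact ⟨_, rfl⟩

/-- The k matching edges on the cycle cover 2k of its 2k + 1 vertices and avoid the base, hence
cover everything else. -/
theorem IsBlossom.adj_of_ne_base [Finite V] {M C : G.Subgraph} (h : IsBlossom G M C)
    (hM : M.IsMatching) {b : V} (hb : IsBase G M C b) {z : V} (hz : z ∈ C.verts) (hzb : z ≠ b) :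
    ∃ w, C.Adj z w ∧ M.Adj z w := by
  let R : G.Subgraph :=
    { verts := {z | ∃ w, C.Adj z w ∧ M.Adj z w}
      Adj := fun z w => C.Adj z w ∧ M.Adj z w
      adj_sub := fun h => h.1.adj_sub
      edge_vert := fun h => ⟨_, h⟩
      symm := ⟨fun _ _ h => ⟨h.1.symm, h.2.symm⟩⟩ }
  have hR : R.IsMatching := by
    rintro v ⟨w, hw⟩
    exact ⟨w, hw, fun w' hw' => hM.eq_of_adj_left hw'.2 hw.2⟩
  have hRe : R.edgeSet = C.edgeSet ∩ M.edgeSet := by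
    ext e
    induction e with | _ x y => rfl
  have h1 := ncard_verts_of_isMatching hR
  have h2 := h.1.ncard_verts
  have h3 := h.2
  have hsub : R.verts ⊆ C.verts \ {b} := by
    rintro v ⟨w, hw⟩
    refine ⟨C.edge_vert hw.1, ?_⟩
    rintro rfl
    exact hb.2 w hw
  have h4 := Set.ncard_sdiff_singleton_add_one hb.1
  have := Set.eq_of_subset_of_ncard_le hsub (by rw [hRe] at h1; omega)
  have hzR : z ∈ R.verts := by rw [this]; exact ⟨hz, hzb⟩
  exact hzR

/-- Switching along the stem from the root frees the base. The stem meets the blossom only there, so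
the matching edges on the blossom survive. -/
theorem exists_isNearPerfectOn_of_isFlower [Finite V] {M C : G.Subgraph}
    (hM : IsMaximumMatching G M) {b r : V} {p : G.Walk b r} (hp : IsFlower G M C p) :
    (∀ y ∈ p.support, y ∈ geD G ∨ ∃ u ∈ geD G, G.Adj u y) ∧ ∃ m, IsNearPerfectOn G C m b := by
  obtain ⟨hbl, hbase, hpath, ⟨n, heven⟩, halt, hr, hdisj⟩ := hp
  obtain ⟨m, hm, hfix, hadj⟩ := exists_isPairing_of_isMatching hM.1
  have hmax := (isMaximumMatching_iff hM.1 hm hfix).1 hM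
  obtain ⟨h1, m', hm', hb, ho⟩ := exists_isMaxPairing_of_isAlternatingWalk (M := M) (m₀ := m)
    (fun v w h => ((hadj v w).1 h).1) n p.reverse (by rw [Walk.length_reverse]; omega) m hmax
    ((hfix r).2 hr) hpath.reverse
    (by
      unfold IsAlternatingWalk at halt ⊢
      rw [Walk.edges_reverse, List.isChain_reverse]
      exact halt.imp fun _ _ h => Or.symm h)
    (by
      intro e he heM
      cases hq : p.reverse with
      | nil => simp [hq] at he
      | @cons _ x _ h q =>
        rw [hq] at he
        have : s(r, x) = e := by simpa using he
        rw [← this] at heM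
        exact hr (M.edge_vert heM))
    (fun _ _ _ => rfl)
  refine ⟨fun y hy => h1 y (by simpa using hy), m', hm', hbase.1, hb, fun z hz hzb => ?_⟩
  obtain ⟨w, hw, hw'⟩ := hbl.adj_of_ne_base hM.1 hbase hz hzb
  rw [ho z (fun h => hzb (hdisj z (by simpa using h) hz)), ((hadj z w).1 hw').1]
  exact hw

/-- Rotating a blossom moves its base to any vertex of the cycle. -/
theorem IsNearPerfectOn.rotate [Finite V] {C : G.Subgraph} (hC : IsOddCycle G C) {m : V → V}
    {b : V} (h : IsNearPerfectOn G C m b) {v : V} (hv : v ∈ C.verts) :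
    ∃ m', IsNearPerfectOn G C m' v := by
  classical
  obtain ⟨n, f, ⟨k, hn⟩, hrange, hper, hadj, hne, hnbr⟩ := hC.exists_enumeration
  have hmem : ∀ i, f i ∈ C.verts := fun i => by rw [hrange]; exact ⟨i, rfl⟩
  have step : ∀ i, (∃ m, IsNearPerfectOn G C m (f i)) →
      ∃ m, IsNearPerfectOn G C m (f (i + 2)) := by
    rintro i ⟨m, hm⟩
    have hinv := hm.max.1.invol
    have h1 : f (i + 1) ≠ f i := (C.adj_sub (hadj i)).ne'
    have h2 : f (i + 1) ≠ f (i + 2) := (hadj (i + 1)).ne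
    have hm1 : m (f (i + 1)) = f (i + 2) := by
      refine (hnbr _ _ (hm.adj _ (hmem _) h1)).resolve_left fun h3 => h1 ?_
      rw [← hinv (f (i + 1)), h3, hm.fix]
    have hm2 : m (f (i + 2)) = f (i + 1) := by rw [← hm1, hinv]
    refine ⟨_, hm.max.conj_swap hm.fix (y := f (i + 2)) ?_, hmem _, by simp [hm.fix], ?_⟩
    · rw [hm2]; exact C.adj_sub (hadj i)
    · intro z hz hz2
      by_cases hz0 : z = f i
      · rw [hz0, Equiv.swap_apply_left, hm2, Equiv.swap_apply_of_ne_of_ne h1 h2]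
        exact hadj i
      · rw [Equiv.swap_apply_of_ne_of_ne hz0 hz2]
        by_cases hz1 : z = f (i + 1)
        · rw [hz1, hm1, Equiv.swap_apply_right]
          exact (hadj i).symm
        · rw [Equiv.swap_apply_of_ne_of_ne]
          · exact hm.adj z hz hz0
          · intro h3; exact hz0 (by rw [← hinv z, h3, hm.fix])
          · intro h3; exact hz1 (by rw [← hinv z, h3, hm2])
  have steps : ∀ j i, (∃ m, IsNearPerfectOn G C m (f i)) →
      ∃ m, IsNearPerfectOn G C m (f (i + 2 * j)) := by
    intro j
    induction j with
    | zero => exact fun i h => h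
    | succ j ih => exact fun i h => step _ (ih i h)
  have hpers : ∀ s i, f (i + s * n) = f i := by
    intro s
    induction s with
    | zero => simp
    | succ s ih => intro i; rw [Nat.succ_mul, ← add_assoc, hper, ih]
  have hb := h.mem
  rw [hrange] at hb hv
  obtain ⟨i, rfl⟩ := hb
  obtain ⟨t, rfl⟩ := hv
  -- The base moves by two positions at a time; as `n` is odd, going round once more if necessary
  -- corrects the parity.
  obtain ⟨s, j, hs⟩ : ∃ s j, i + 2 * j = t + s * n := by
    have hle : i ≤ i * n := Nat.le_mul_of_pos_right _ (by omega)
    rcases Nat.even_or_odd' (t + i * n - i) with ⟨j, hj | hj⟩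
    · exact ⟨i, j, by omega⟩
    · refine ⟨i + 1, j + k + 1, ?_⟩
      have : (i + 1) * n = i * n + n := Nat.succ_mul i n
      omega
  have := steps j i ⟨m, h⟩
  rwa [hs, hpers] at this

/-- The structure of an almost bipartite graph that is covered by flowers. -/
structure IsFlowerGraph (G : SimpleGraph V) (C : G.Subgraph) : Prop where
  cycle : IsOddCycle G C
  unique : ∀ C', IsOddCycle G C' → C' = C
  odd : Odd C.verts.ncard
  cover : ∀ v, v ∈ geD G ∨ v ∈ geA G
  near : ∀ v ∈ C.verts, ∃ m, IsNearPerfectOn G C m v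

/-- A single flower, rotated, makes every cycle vertex missable. Stem vertices lie in D or next to
it, so flowers covering the graph leave no room for C(G). -/
theorem isFlowerGraph_of_reachSet [Finite V] {C : G.Subgraph} (hC : IsOddCycle G C)
    (hu : ∀ C', IsOddCycle G C' → C' = C) (hR : reachSet G C = Set.univ) :
    IsFlowerGraph G C := by
  have hne : ∃ v, v ∈ C.verts := by
    obtain ⟨u, p, -, -, rfl⟩ := hC
    exact ⟨u, by simp⟩
  have key : ∀ {M : G.Subgraph}, IsMaximumMatching G M → ∀ {b r : V} {p : G.Walk b r},
      IsFlower G M C p → ∀ v ∈ C.verts, ∃ m, IsNearPerfectOn G C m v := by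
    intro M hM b r p hp v hv
    obtain ⟨m, hm⟩ := (exists_isNearPerfectOn_of_isFlower hM hp).2
    exact hm.rotate hC hv
  obtain ⟨v₀, -⟩ := hne
  obtain ⟨M₀, hM₀, b₀, r₀, p₀, hp₀, -⟩ : v₀ ∈ reachSet G C := by rw [hR]; trivial
  refine ⟨hC, hu, hp₀.1.odd_ncard_verts, fun v => ?_, key hM₀ hp₀⟩
  obtain ⟨M, hM, b, r, p, hp, hv⟩ : v ∈ reachSet G C := by rw [hR]; trivial
  rcases hv with hv | hv
  · obtain ⟨m, hm⟩ := key hM hp v hv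
    exact Or.inl (mem_geD_iff.2 ⟨m, hm.max, hm.fix⟩)
  · by_cases hD : v ∈ geD G
    · exact Or.inl hD
    · exact Or.inr ⟨hD, ((exists_isNearPerfectOn_of_isFlower hM hp).1 v hv).resolve_left hD⟩

theorem IsFlowerGraph.verts_subset_geD [Finite V] {C : G.Subgraph} (h : IsFlowerGraph G C) :
    C.verts ⊆ geD G := by
  intro v hv
  obtain ⟨m, hm⟩ := h.near v hv
  exact mem_geD_iff.2 ⟨m, hm.max, hm.fix⟩

theorem IsMaxPairing.deleteEdges {m : V → V} (hm : IsMaxPairing G m) {x y : V} (h : m x ≠ y) :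
    IsMaxPairing (G.deleteEdges {s(x, y)}) m := by
  refine ⟨⟨hm.1.invol, fun v hv => ?_⟩, fun m' hm' => hm.2 _ (hm'.mono (deleteEdges_le _))⟩
  rw [deleteEdges_adj]
  refine ⟨hm.1.adj v hv, fun h' => ?_⟩
  rw [Set.mem_singleton_iff, Sym2.eq_iff] at h'
  rcases h' with ⟨rfl, h1⟩ | ⟨rfl, h1⟩
  · exact h h1
  · exact h (by rw [← h1, hm.1.invol])

/-- Adjacent vertices missed by maximum matchings lie on the odd cycle. -/
theorem IsFlowerGraph.adj_of_mem_geD [Finite V] {C : G.Subgraph} (h : IsFlowerGraph G C) {u v : V}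
    (hu : u ∈ geD G) (hv : v ∈ geD G) (huv : G.Adj u v) : C.Adj u v := by
  obtain ⟨m, hm, hmu⟩ := mem_geD_iff.1 hu
  obtain ⟨m', hm', hmv⟩ := mem_geD_iff.1 hv
  -- Deleting a cycle edge unused by both matchings gives a bipartite graph in which both stay
  -- maximum. There `u` and `v` are nonadjacent, so `uv` can only be the deleted edge.
  obtain ⟨x, y, hxy, h1, h2⟩ := h.cycle.exists_adj_notMem hm.1.invol hm'.1.invol
  by_contra hC
  refine not_adj_of_mem_geD (isBipartite_deleteEdges h.unique hxy)
    (mem_geD_iff.2 ⟨m, hm.deleteEdges h1, hmu⟩) (mem_geD_iff.2 ⟨m', hm'.deleteEdges h2, hmv⟩) ?_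
  rw [deleteEdges_adj]
  refine ⟨huv, fun h' => hC ?_⟩
  rw [← Subgraph.mem_edgeSet, show s(u, v) = s(x, y) from h']
  exact hxy

/-- Maximum matchings match `A(G)` into `D(G)`. -/
theorem IsFlowerGraph.apply_mem_geD [Finite V] {C : G.Subgraph} (h : IsFlowerGraph G C)
    {m : V → V} (hm : IsMaxPairing G m) {a : V} (ha : a ∈ geA G) : m a ∈ geD G := by
  obtain ⟨haD, d, hd, hda⟩ := ha
  obtain ⟨m', hm', hmd⟩ := mem_geD_iff.1 hd
  obtain ⟨x, y, hxy, h1, h2⟩ := h.cycle.exists_adj_notMem hm.1.invol hm'.1.invol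
  -- The deletion keeps the matching number, so its maximum matchings are maximum in `G`.
  have hsub : geD (G.deleteEdges {s(x, y)}) ⊆ geD G := by
    intro v hv
    obtain ⟨m'', hm'', hv⟩ := mem_geD_iff.1 hv
    exact mem_geD_iff.2 ⟨m'', hm.of_ncard_le (hm''.1.mono (deleteEdges_le _))
      (hm''.ncard_eq (hm.deleteEdges h1)).le, hv⟩
  refine hsub (apply_mem_geD_of_isBipartite (isBipartite_deleteEdges h.unique hxy)
    (hm.deleteEdges h1) ⟨fun h' => haD (hsub h'), d,
      mem_geD_iff.2 ⟨m', hm'.deleteEdges h2, hmd⟩, ?_⟩)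
  rw [deleteEdges_adj]
  refine ⟨hda, fun h' => haD (h.verts_subset_geD ?_)⟩
  have : C.Adj d a := by
    rw [← Subgraph.mem_edgeSet, show s(d, a) = s(x, y) from h']
    exact hxy
  exact C.edge_vert this.symm

end OddPiece

/-! ### Consequences of a certificate -/

section Certificate

variable {V ι : Type*} {G : SimpleGraph V}

theorem IsPairing.even_ncard [Finite V] {m : V → V} (hm : IsPairing G m) {S : Set V}
    (h : ∀ v ∈ S, m v ∈ S ∧ m v ≠ v) : Even S.ncard := by
  let M : G.Subgraph :=
    { verts := S
      Adj := fun v w => v ∈ S ∧ m v = w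
      adj_sub := by
        rintro v w ⟨hv, rfl⟩
        exact hm.adj v (h v hv).2
      edge_vert := fun h => h.1
      symm := ⟨by
        rintro v w ⟨hv, rfl⟩
        exact ⟨(h v hv).1, hm.invol v⟩⟩ }
  have hM : M.IsMatching := fun v hv => ⟨m v, ⟨hv, rfl⟩, fun _ h => h.2.symm⟩
  have := ncard_verts_of_isMatching hM
  exact ⟨M.edgeSet.ncard, by rw [← two_mul]; exact this⟩

/-- A matching that misses `f i` in each `Q i`, matches `A` into `X`, matches `R` perfectly, and
matches the remaining vertices of each `Q i` among themselves. -/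
structure IsTight (G : SimpleGraph V) (X A R : Set V) (Q : ι → Set V) (f : ι → V) (m : V → V) :
    Prop where
  pairing : IsPairing G m
  fix : ∀ i, m (f i) = f i
  part : ∀ i, ∀ z ∈ Q i, z ≠ f i → m z ∈ Q i ∧ m z ≠ z
  barrier : ∀ a ∈ A, m a ∈ X
  rest : ∀ c ∈ R, m c ∈ R ∧ m c ≠ c

/-- A Gallai–Edmonds type partition of the vertices into the barrier `A`, the set `X` of trivial
components and the odd components `Q i` left by `A`, and a bipartite rest `R`. -/
structure IsCertificate (G : SimpleGraph V) (X A R : Set V) (Q : ι → Set V) (col : V → Bool) :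
    Prop where
  cover : ∀ v, v ∈ X ∨ v ∈ A ∨ v ∈ R ∨ ∃ i, v ∈ Q i
  disjoint_XA : ∀ v ∈ X, v ∉ A
  disjoint_XR : ∀ v ∈ X, v ∉ R
  disjoint_AR : ∀ v ∈ A, v ∉ R
  disjoint_Q : ∀ i, ∀ v ∈ Q i, v ∉ X ∧ v ∉ A ∧ v ∉ R
  disjoint_QQ : ∀ i j, ∀ v ∈ Q i, v ∈ Q j → i = j
  odd : ∀ i, Odd (Q i).ncard
  adj_X : ∀ v ∈ X, ∀ w, G.Adj v w → w ∈ A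
  adj_Q : ∀ i, ∀ v ∈ Q i, ∀ w, G.Adj v w → w ∈ A ∨ w ∈ Q i
  exists_adj_Q : ∀ i, ∀ v ∈ Q i, ∃ w ∈ Q i, G.Adj v w
  coloring : ∀ v ∈ R, ∀ w ∈ R, G.Adj v w → col v ≠ col w
  exists_tight : ∀ f : ι → V, (∀ i, f i ∈ Q i) → ∃ m, IsTight G X A R Q f m
  exists_fix_X : ∀ v ∈ X, ∃ m m₀ f, (∀ i, f i ∈ Q i) ∧ IsTight G X A R Q f m₀ ∧ IsPairing G m ∧
    m v = v ∧ (fixedPoints m).ncard = (fixedPoints m₀).ncard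

variable {X A R : Set V} {Q : ι → Set V} {col : V → Bool} {f : ι → V} {m : V → V}

theorem IsCertificate.fixedPoints_subset (h : IsCertificate G X A R Q col)
    (hm : IsTight G X A R Q f m) : fixedPoints m ⊆ Set.range f ∪ (X \ m '' A) := by
  intro v hv
  have hv : m v = v := hv
  rcases h.cover v with hX | hA | hR | ⟨i, hi⟩
  · refine Or.inr ⟨hX, ?_⟩
    rintro ⟨a, ha, rfl⟩
    rw [hm.pairing.invol] at hv
    exact h.disjoint_XA _ hX (hv ▸ ha)
  · have := hm.barrier v hA
    rw [hv] at this
    exact (h.disjoint_XA v this hA).elim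
  · exact ((hm.rest v hR).2 hv).elim
  · by_cases hf : v = f i
    · exact Or.inl ⟨i, hf.symm⟩
    · exact ((hm.part i v hi hf).2 hv).elim

theorem IsTight.ncard_sdiff_image [Finite V] (hm : IsTight G X A R Q f m) :
    (X \ m '' A).ncard + A.ncard = X.ncard := by
  have hsub : m '' A ⊆ X := by
    rintro _ ⟨a, ha, rfl⟩
    exact hm.barrier a ha
  rw [← Set.ncard_sdiff_add_ncard_of_subset hsub,
    Set.ncard_image_of_injective _ hm.pairing.injective]

theorem IsCertificate.ncard_fixedPoints_le [Finite V] [Finite ι] (h : IsCertificate G X A R Q col)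
    (hm : IsTight G X A R Q f m) : (fixedPoints m).ncard + A.ncard ≤ X.ncard + Nat.card ι := by
  have h1 := Set.ncard_le_ncard (h.fixedPoints_subset hm)
  have h2 := Set.ncard_union_le (Set.range f) (X \ m '' A)
  have h3 := hm.ncard_sdiff_image
  have h4 : (Set.range f).ncard ≤ Nat.card ι := by
    rw [← Set.image_univ, ← Set.ncard_univ]
    exact Set.ncard_image_le
  omega

/-- Every matching misses at least `|X| + k - |A|` vertices, and only vertices outside `A ∪ R` in
the case of equality. -/
theorem IsCertificate.le_ncard_fixedPoints [Finite V] [Finite ι] (h : IsCertificate G X A R Q col)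
    (hm : IsPairing G m) : X.ncard + Nat.card ι ≤ (fixedPoints m).ncard + A.ncard ∧
      ((fixedPoints m).ncard + A.ncard ≤ X.ncard + Nat.card ι →
        ∀ v, m v = v → v ∈ X ∨ ∃ i, v ∈ Q i) := by
  -- By parity `Q i` cannot be matched within itself. The saturated vertices among `X` and the
  -- chosen `z i` therefore inject into `A`; in the equality case all missed vertices are among
  -- these.
  have hz : ∀ i, ∃ z ∈ Q i, m z = z ∨ m z ∈ A := by
    intro i
    by_contra! hcon
    refine Nat.not_even_iff_odd.2 (h.odd i) (hm.even_ncard (m := m) fun v hv => ⟨?_, (hcon v hv).1⟩)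
    exact (h.adj_Q i v hv _ (hm.adj v (hcon v hv).1)).resolve_left (hcon v hv).2
  choose z hzQ hz using hz
  have hzinj : Injective z := fun i j hij => h.disjoint_QQ i j _ (hzQ i) (hij ▸ hzQ j)
  have hW : (X ∪ Set.range z).ncard = X.ncard + Nat.card ι := by
    rw [Set.ncard_union_eq, ← Set.image_univ, Set.ncard_image_of_injective _ hzinj, Set.ncard_univ]
    rw [Set.disjoint_left]
    rintro _ hX ⟨i, rfl⟩
    exact (h.disjoint_Q i _ (hzQ i)).1 hX
  have hWA : m '' ((X ∪ Set.range z) \ fixedPoints m) ⊆ A := by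
    rintro _ ⟨v, ⟨hv | ⟨i, rfl⟩, hfix⟩, rfl⟩
    · exact h.adj_X v hv _ (hm.adj v hfix)
    · exact (hz i).resolve_left hfix
  have h1 := Set.ncard_le_ncard hWA
  rw [Set.ncard_image_of_injective _ hm.injective] at h1
  have h2 := Set.ncard_inter_add_ncard_sdiff_eq_ncard (X ∪ Set.range z) (fixedPoints m)
  have h3 : ((X ∪ Set.range z) ∩ fixedPoints m).ncard ≤ (fixedPoints m).ncard :=
    Set.ncard_le_ncard Set.inter_subset_right
  refine ⟨by omega, fun hle v hv => ?_⟩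
  have h4 := Set.eq_of_subset_of_ncard_le
    (Set.inter_subset_right (s := X ∪ Set.range z) (t := fixedPoints m)) (by omega)
  have hv' : v ∈ (X ∪ Set.range z) ∩ fixedPoints m := by rw [h4]; exact hv
  rcases hv'.1 with hX | ⟨i, rfl⟩
  · exact Or.inl hX
  · exact Or.inr ⟨i, hzQ i⟩

theorem IsCertificate.isMaxPairing [Finite V] [Finite ι] (h : IsCertificate G X A R Q col)
    (hm : IsTight G X A R Q f m) : IsMaxPairing G m := by
  refine ⟨hm.pairing, fun m' hm' => ?_⟩
  have h1 := h.ncard_fixedPoints_le hm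
  have h2 := (h.le_ncard_fixedPoints hm').1
  omega

theorem IsCertificate.exists_mem (h : IsCertificate G X A R Q col) : ∃ f : ι → V, ∀ i, f i ∈ Q i :=
  Classical.skolem.1 fun i => Set.nonempty_of_ncard_ne_zero (h.odd i).pos.ne'

/-- The equality case of the count confines missed vertices to `X` and the `Q i`. Conversely, a
vertex of `Q i` can be prescribed as the one a tight matching misses, and `exists_fix_X` handles
`X`. -/
theorem IsCertificate.mem_geD [Finite V] [Finite ι] (h : IsCertificate G X A R Q col) {v : V} :
    v ∈ geD G ↔ v ∈ X ∨ ∃ i, v ∈ Q i := by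
  classical
  obtain ⟨f, hf⟩ := h.exists_mem
  rw [mem_geD_iff]
  constructor
  · rintro ⟨m, hm, hv⟩
    obtain ⟨m₀, hm₀⟩ := h.exists_tight f hf
    refine (h.le_ncard_fixedPoints hm.1).2 ?_ v hv
    rw [hm.ncard_eq (h.isMaxPairing hm₀)]
    exact h.ncard_fixedPoints_le hm₀
  · rintro (hX | ⟨i, hi⟩)
    · obtain ⟨m, m₀, f, -, hm₀, hm, hv, hcard⟩ := h.exists_fix_X v hX
      exact ⟨m, (h.isMaxPairing hm₀).of_ncard_le hm hcard.le, hv⟩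
    · obtain ⟨m, hm⟩ := h.exists_tight (update f i v) fun j => by
        by_cases hj : j = i
        · subst hj; simpa using hi
        · simpa [hj] using hf j
      exact ⟨m, h.isMaxPairing hm, by simpa using hm.fix i⟩

theorem IsCertificate.mem_setY [Finite V] [Finite ι] (h : IsCertificate G X A R Q col) {v : V} :
    v ∈ setY G ↔ ∃ i, v ∈ Q i := by
  constructor
  · rintro ⟨hD, hX⟩
    refine (h.mem_geD.1 hD).resolve_left fun hv => hX ⟨hD, fun u hu huv => ?_⟩
    have hA := h.adj_X v hv u huv
    rcases h.mem_geD.1 hu with hu | ⟨i, hu⟩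
    · exact h.disjoint_XA u hu hA
    · exact (h.disjoint_Q i u hu).2.1 hA
  · rintro ⟨i, hi⟩
    obtain ⟨w, hw, hvw⟩ := h.exists_adj_Q i v hi
    exact ⟨h.mem_geD.2 (Or.inr ⟨i, hi⟩), fun hX => hX.2 w (h.mem_geD.2 (Or.inr ⟨i, hw⟩)) hvw⟩

/-! ### Critical independent sets -/

theorem notMem_nbhd_of_isIndepSet {S : Set V} (hS : G.IsIndepSet S) {v : V} (hv : v ∈ nbhd G S) :
    v ∉ S := by
  obtain ⟨u, hu, huv⟩ := hv
  exact fun h => hS hu h huv.ne huv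

/-- An independent set has difference at most `|X| - |A|`, and less if it has neighbours in some
`Q i`. -/
theorem IsCertificate.ncard_le_of_isIndepSet [Finite V] (h : IsCertificate G X A R Q col)
    {S : Set V} (hS : G.IsIndepSet S) : S.ncard + A.ncard ≤ (nbhd G S).ncard + X.ncard ∧
      ((∃ i, ∃ z ∈ Q i, z ∈ nbhd G S) → S.ncard + A.ncard < (nbhd G S).ncard + X.ncard) := by
  -- If N(S) misses `Q i`, so does `S`, because every vertex of `Q i` has a neighbour in `Q i`.
  have hex : ∀ i, ∃ z ∈ Q i, z ∉ S ∧ ((∃ z ∈ Q i, z ∈ nbhd G S) → z ∈ nbhd G S) := by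
    intro i
    by_cases hi : ∃ z ∈ Q i, z ∈ nbhd G S
    · obtain ⟨z, hz, hzS⟩ := hi
      exact ⟨z, hz, notMem_nbhd_of_isIndepSet hS hzS, fun _ => hzS⟩
    · obtain ⟨z, hz⟩ := Set.nonempty_of_ncard_ne_zero (h.odd i).pos.ne'
      obtain ⟨w, hw, hzw⟩ := h.exists_adj_Q i z hz
      exact ⟨z, hz, fun hzS => hi ⟨w, hw, z, hzS, hzw⟩, fun h' => (hi h').elim⟩
  choose f hfQ hfS hfN using hex
  obtain ⟨m, hm⟩ := h.exists_tight f hfQ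
  have h1 : S ∩ fixedPoints m ⊆ X \ m '' A := by
    rintro v ⟨hv, hfix⟩
    refine (h.fixedPoints_subset hm hfix).resolve_left ?_
    rintro ⟨i, rfl⟩
    exact hfS i hv
  have h2 : m '' (S \ fixedPoints m) ⊆ nbhd G S \ fixedPoints m := by
    rintro _ ⟨v, ⟨hv, hfix⟩, rfl⟩
    refine ⟨⟨v, hv, hm.pairing.adj v hfix⟩, fun h' => hfix ?_⟩
    exact hm.pairing.injective h'
  have h3 := Set.ncard_le_ncard h1
  have h4 := Set.ncard_le_ncard h2
  rw [Set.ncard_image_of_injective _ hm.pairing.injective] at h4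
  have h5 := Set.ncard_inter_add_ncard_sdiff_eq_ncard S (fixedPoints m)
  have h6 := hm.ncard_sdiff_image
  have h7 : (nbhd G S \ fixedPoints m).ncard ≤ (nbhd G S).ncard :=
    Set.ncard_le_ncard Set.sdiff_subset
  refine ⟨by omega, fun ⟨i, hi⟩ => ?_⟩
  -- The missed vertex `f i` belongs to N(S) but is nobody's partner, which makes the bound strict.
  have h8 : (nbhd G S \ fixedPoints m).ncard < (nbhd G S).ncard :=
    Set.ncard_lt_ncard ⟨Set.sdiff_subset, fun h' => (h' (hfN i hi)).2 (hm.fix i)⟩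
  omega

/-- The vertices of `X` and of one colour class of `R`. -/
def colorSet (X R : Set V) (col : V → Bool) (c : Bool) : Set V := X ∪ {v | v ∈ R ∧ col v = c}

theorem IsCertificate.isIndepSet_colorSet (h : IsCertificate G X A R Q col) (c : Bool) :
    G.IsIndepSet (colorSet X R col c) := by
  have key : ∀ u ∈ X, ∀ v ∈ colorSet X R col c, ¬ G.Adj u v := by
    intro u hu v hv huv
    have hA := h.adj_X u hu v huv
    exact hv.elim (fun h' => h.disjoint_XA v h' hA) fun h' => h.disjoint_AR v hA h'.1
  rintro u (hu | hu) v hv - huv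
  · exact key u hu v hv huv
  · rcases hv with hv | hv
    · exact key v hv u (Or.inr hu) huv.symm
    · exact h.coloring u hu.1 v hv.1 huv (by rw [hu.2, hv.2])

/-- Neighbours lie in `A` or in the opposite class of `R`. A tight matching pairs the two classes,
so their sizes cancel and the difference reaches |X| - |A|. -/
theorem IsCertificate.isCriticalIndep_colorSet [Finite V] [Finite ι]
    (h : IsCertificate G X A R Q col) (c : Bool) : IsCriticalIndep G (colorSet X R col c) := by
  obtain ⟨f, hf⟩ := h.exists_mem
  obtain ⟨m, hm⟩ := h.exists_tight f hf
  refine ⟨h.isIndepSet_colorSet c, fun T hT => ?_⟩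
  have hcard : ∀ c, (colorSet X R col c).ncard = X.ncard + {v | v ∈ R ∧ col v = c}.ncard := by
    intro c
    refine Set.ncard_union_eq ?_
    rw [Set.disjoint_left]
    exact fun v hX hR => h.disjoint_XR v hX hR.1
  have hsub : nbhd G (colorSet X R col c) ⊆ A ∪ {v | v ∈ R ∧ col v = !c} := by
    rintro v ⟨u, hu | hu, huv⟩
    · exact Or.inl (h.adj_X u hu v huv)
    · rcases h.cover v with hX | hA | hR | ⟨i, hi⟩
      · exact (h.disjoint_AR u (h.adj_X v hX u huv.symm) hu.1).elim
      · exact Or.inl hA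
      · have := h.coloring u hu.1 v hR huv
        rw [hu.2] at this
        refine Or.inr ⟨hR, ?_⟩
        revert this
        cases col v <;> cases c <;> simp
      · rcases h.adj_Q i v hi u huv.symm with h' | h'
        · exact (h.disjoint_AR u h' hu.1).elim
        · exact ((h.disjoint_Q i u h').2.2 hu.1).elim
  have hhalf : {v | v ∈ R ∧ col v = !c}.ncard ≤ {v | v ∈ R ∧ col v = c}.ncard := by
    rw [← Set.ncard_image_of_injective _ hm.pairing.injective]
    refine Set.ncard_le_ncard ?_
    rintro _ ⟨v, ⟨hv, hc⟩, rfl⟩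
    have h1 := hm.rest v hv
    have h2 := h.coloring v hv _ h1.1 (hm.pairing.adj v h1.2)
    rw [hc] at h2
    refine ⟨h1.1, ?_⟩
    revert h2
    cases col (m v) <;> cases c <;> simp
  have h1 := (h.ncard_le_of_isIndepSet hT).1
  have h2 := Set.ncard_le_ncard hsub
  have h3 := Set.ncard_union_le A {v | v ∈ R ∧ col v = !c}
  have h4 := hcard c
  unfold diff
  omega

theorem IsCertificate.notMem_nbhd_of_isCriticalIndep [Finite V] [Finite ι]
    (h : IsCertificate G X A R Q col) {S : Set V} (hS : IsCriticalIndep G S) {i : ι} {z : V}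
    (hz : z ∈ Q i) : z ∉ nbhd G S := by
  intro hzS
  have h1 := (h.ncard_le_of_isIndepSet hS.1).2 ⟨i, z, hz, hzS⟩
  have h2 : G.IsIndepSet X := fun u hu v hv _ huv => h.disjoint_XA v hv (h.adj_X u hu v huv)
  have h3 := hS.2 X h2
  have h4 : (nbhd G X).ncard ≤ A.ncard :=
    Set.ncard_le_ncard fun v ⟨u, hu, huv⟩ => h.adj_X u hu v huv
  unfold diff at h3
  omega

theorem IsCertificate.notMem_of_isCriticalIndep [Finite V] [Finite ι]
    (h : IsCertificate G X A R Q col) {S : Set V} (hS : IsCriticalIndep G S) {i : ι} {z : V}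
    (hz : z ∈ Q i) : z ∉ S := by
  intro hzS
  obtain ⟨w, hw, hzw⟩ := h.exists_adj_Q i z hz
  exact h.notMem_nbhd_of_isCriticalIndep hS hw ⟨z, hzS, hzw⟩

/-- A critical set avoids every `Q i`; replacing its vertices outside the colour set by their tight
partners maps it into the colour set. Independence prevents collisions. -/
theorem IsCertificate.isMaximumCriticalIndep_colorSet [Finite V] [Finite ι]
    (h : IsCertificate G X A R Q col) (c : Bool) :
    IsMaximumCriticalIndep G (colorSet X R col c) := by
  classical
  refine ⟨h.isCriticalIndep_colorSet c, fun T hT => ?_⟩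
  obtain ⟨f, hf⟩ := h.exists_mem
  obtain ⟨m, hm⟩ := h.exists_tight f hf
  have hne : ∀ v ∈ T, v ∉ colorSet X R col c → m v ∈ colorSet X R col c ∧ m v ≠ v := by
    intro v hv hvc
    rcases h.cover v with hX | hA | hR | ⟨i, hi⟩
    · exact (hvc (Or.inl hX)).elim
    · have := hm.barrier v hA
      exact ⟨Or.inl this, fun h' => h.disjoint_XA v (h' ▸ this) hA⟩
    · have h1 := hm.rest v hR
      have h2 := h.coloring v hR _ h1.1 (hm.pairing.adj v h1.2)
      have h3 : col v ≠ c := fun h' => hvc (Or.inr ⟨hR, h'⟩)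
      refine ⟨Or.inr ⟨h1.1, ?_⟩, h1.2⟩
      revert h2 h3
      cases col v <;> cases col (m v) <;> cases c <;> simp
    · exact (h.notMem_of_isCriticalIndep hT hi hv).elim
  have hcross : ∀ u ∈ T, ∀ v ∈ T, v ∉ colorSet X R col c → u ≠ m v := by
    rintro u hu v hv hvc rfl
    have := (hne v hv hvc).2
    exact hT.1 hv hu this.symm (hm.pairing.adj v this)
  refine Set.ncard_le_ncard_of_injOn (fun v => if v ∈ colorSet X R col c then v else m v) ?_ ?_
  · intro v hv
    split_ifs with h'
    · exact h'
    · exact (hne v hv h').1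
  · intro u hu v hv huv
    dsimp only at huv
    split_ifs at huv with h1 h2 h2
    · exact huv
    · exact (hcross u hu v hv h2 huv).elim
    · exact (hcross v hv u hu h1 huv.symm).elim
    · exact hm.pairing.injective huv

theorem IsCertificate.nucleus_subset [Finite V] [Finite ι] (h : IsCertificate G X A R Q col) :
    nucleus G ⊆ X := by
  intro v hv
  rcases hv _ (h.isMaximumCriticalIndep_colorSet true) with h1 | h1
  · exact h1
  rcases hv _ (h.isMaximumCriticalIndep_colorSet false) with h2 | h2
  · exact h2
  exact absurd (h1.2.symm.trans h2.2) (by decide)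

/-- The difference bound applied to `X` itself forces |A| ≤ |N(X)|. -/
theorem IsCertificate.nbhd_eq [Finite V] [Finite ι] (h : IsCertificate G X A R Q col) :
    nbhd G X = A := by
  have h2 : G.IsIndepSet X := fun u hu v hv _ huv => h.disjoint_XA v hv (h.adj_X u hu v huv)
  refine Set.eq_of_subset_of_ncard_le (fun v ⟨u, hu, huv⟩ => h.adj_X u hu v huv) ?_
  have := (h.ncard_le_of_isIndepSet h2).1
  omega

theorem IsCertificate.mem_closedNbhd_diadem [Finite V] [Finite ι]
    (h : IsCertificate G X A R Q col) {v : V} :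
    v ∈ closedNbhd G (diadem G) ↔ ¬ ∃ i, v ∈ Q i := by
  have hX : X ⊆ diadem G := fun v hv => ⟨_, h.isCriticalIndep_colorSet true, Or.inl hv⟩
  constructor
  · rintro (⟨S, hS, hv⟩ | ⟨u, ⟨S, hS, hu⟩, huv⟩) ⟨i, hi⟩
    · exact h.notMem_of_isCriticalIndep hS hi hv
    · exact h.notMem_nbhd_of_isCriticalIndep hS hi ⟨u, hu, huv⟩
  · intro hv
    rcases h.cover v with h' | h' | h' | h'
    · exact Or.inl (hX h')
    · rw [← h.nbhd_eq] at h'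
      obtain ⟨u, hu, huv⟩ := h'
      exact Or.inr ⟨u, hX hu, huv⟩
    · exact Or.inl ⟨_, h.isCriticalIndep_colorSet (col v), Or.inr ⟨h', rfl⟩⟩
    · exact (hv h').elim

theorem IsCertificate.closedNbhd_diadem_eq [Finite V] [Finite ι]
    (h : IsCertificate G X A R Q col) : closedNbhd G (diadem G) = (setY G)ᶜ := by
  ext v
  rw [h.mem_closedNbhd_diadem, Set.mem_compl_iff, h.mem_setY]

theorem IsCertificate.nucleus_subset_geD [Finite V] [Finite ι]
    (h : IsCertificate G X A R Q col) : nucleus G ⊆ geD G :=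
  fun _ hv => h.mem_geD.2 (Or.inl (h.nucleus_subset hv))

end Certificate

theorem partition_of_nucleus_subset {V : Type*} {G : SimpleGraph V} (h : nucleus G ⊆ geD G) :
    nucleus G ∪ (geD G \ nucleus G) ∪ geA G ∪ geC G = Set.univ ∧
      [nucleus G, geD G \ nucleus G, geA G, geC G].Pairwise Disjoint := by
  have hDA : Disjoint (geD G) (geA G) := Set.disjoint_left.2 fun v hD hA => hA.1 hD
  have hDC : Disjoint (geD G) (geC G) := Set.disjoint_left.2 fun v hD hC => hC (Or.inl hD)
  have hAC : Disjoint (geA G) (geC G) := Set.disjoint_left.2 fun v hA hC => hC (Or.inr hA)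
  constructor
  · rw [Set.union_sdiff_cancel h, geC, Set.union_compl_self]
  · simp only [List.pairwise_cons, List.mem_cons, List.not_mem_nil, or_false, forall_eq_or_imp,
      forall_eq, List.Pairwise.nil, and_true, IsEmpty.forall_iff, implies_true]
    exact ⟨⟨Set.disjoint_sdiff_right, hDA.mono_left h, hDC.mono_left h⟩,
      ⟨hDA.mono_left Set.sdiff_subset, hDC.mono_left Set.sdiff_subset⟩, hAC⟩

/-! ### Gluing the pieces into a certificate -/

section Pieces

variable {V : Type*} {G : SimpleGraph V}

/-- A partner in D would put `c` in A, and partners of A lie in D. -/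
theorem apply_mem_geC {m : V → V} [Finite V] (hm : IsMaxPairing G m)
    (hA : ∀ a ∈ geA G, m a ∈ geD G) {c : V} (hc : c ∈ geC G) : m c ∈ geC G ∧ m c ≠ c := by
  have hcD : c ∉ geD G := fun h => hc (Or.inl h)
  have hne : m c ≠ c := fun h => hcD (mem_geD_iff.2 ⟨m, hm, h⟩)
  refine ⟨?_, hne⟩
  rintro (h | h)
  · exact hc (Or.inr ⟨hcD, m c, h, (hm.1.adj c hne).symm⟩)
  · have := hA _ h
    rw [hm.1.invol] at this
    exact hcD this

theorem IsFlowerGraph.notMem_geC {C : G.Subgraph} (h : IsFlowerGraph G C) (v : V) : v ∉ geC G :=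
  fun hv => hv (h.cover v)

theorem IsFlowerGraph.apply_notMem_verts [Finite V] {C : G.Subgraph} (h : IsFlowerGraph G C)
    {m : V → V} {b : V} (hm : IsNearPerfectOn G C m b) {a : V} (ha : a ∈ geA G) :
    m a ∉ C.verts := by
  intro hmem
  by_cases hb : m a = b
  · have := hm.max.1.invol a
    rw [hb, hm.fix] at this
    exact ha.1 (h.verts_subset_geD (this ▸ hm.mem))
  · have := hm.adj _ hmem hb
    rw [hm.max.1.invol] at this
    exact ha.1 (h.verts_subset_geD (C.edge_vert this.symm))

variable {ι : Type*} {P : ι → Set V}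

/-- The vertices that lie in `S i` for their piece `P i`. -/
def liftSet (P : ι → Set V) (S : ∀ i, Set (P i)) : Set V := {v | ∃ i, ∃ h : v ∈ P i, ⟨v, h⟩ ∈ S i}

theorem mem_liftSet (hP : ∀ i j v, v ∈ P i → v ∈ P j → i = j) {S : ∀ i, Set (P i)} {i : ι}
    {v : V} (h : v ∈ P i) : v ∈ liftSet P S ↔ ⟨v, h⟩ ∈ S i := by
  constructor
  · rintro ⟨j, hj, hS⟩
    obtain rfl := hP i j v h hj
    exact hS
  · exact fun hS => ⟨i, h, hS⟩

/-- The function that acts as `M i` on `P i`. -/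
def glue {idx : V → ι} (hidx : ∀ v, v ∈ P (idx v)) (M : ∀ i, P i → P i) (v : V) : V :=
  M (idx v) ⟨v, hidx v⟩

section Glue

variable {idx : V → ι} (hidx : ∀ v, v ∈ P (idx v)) {M : ∀ i, P i → P i}

theorem glue_apply (hP : ∀ i j v, v ∈ P i → v ∈ P j → i = j) {i : ι} {v : V} (h : v ∈ P i) :
    glue hidx M v = M i ⟨v, h⟩ := by
  obtain rfl := hP _ _ v (hidx v) h
  rfl

theorem isPairing_glue (hP : ∀ i j v, v ∈ P i → v ∈ P j → i = j)
    (hM : ∀ i, IsPairing (G.induce (P i)) (M i)) : IsPairing G (glue hidx M) := by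
  constructor
  · intro v
    change glue hidx M (M (idx v) ⟨v, hidx v⟩ : P (idx v)) = v
    rw [glue_apply hidx hP (M (idx v) ⟨v, hidx v⟩).2]
    exact congrArg Subtype.val ((hM (idx v)).invol _)
  · intro v hv
    exact (hM (idx v)).adj _ fun h => hv (congrArg Subtype.val h)

theorem ncard_fixedPoints_glue (hP : ∀ i j v, v ∈ P i → v ∈ P j → i = j)
    {M' : ∀ i, P i → P i} [Finite V] [Finite ι]
    (h : ∀ i, (fixedPoints (M i)).ncard = (fixedPoints (M' i)).ncard) :
    (fixedPoints (glue hidx M)).ncard = (fixedPoints (glue hidx M')).ncard := by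
  have key : ∀ M : ∀ i, P i → P i, (fixedPoints (glue hidx M)).ncard =
      Nat.card (Σ i, fixedPoints (M i)) := by
    intro M
    rw [← Nat.card_coe_set_eq]
    refine Nat.card_congr ⟨fun v => ⟨idx v, ⟨v, hidx v⟩, Subtype.ext v.2⟩, fun x => ⟨x.2.1.1, ?_⟩,
      fun v => rfl, ?_⟩
    · have : glue hidx M x.2.1.1 = x.2.1.1 := by
        rw [glue_apply hidx hP x.2.1.2]
        exact congrArg Subtype.val x.2.2
      exact this
    · rintro ⟨i, ⟨v, hv⟩, hfix⟩
      obtain rfl := hP _ _ v (hidx v) hv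
      rfl
  have := Fintype.ofFinite ι
  rw [key, key, Nat.card_sigma, Nat.card_sigma]
  exact Finset.sum_congr rfl fun i _ => by simpa [Nat.card_coe_set_eq] using h i

end Glue

/-- The vertices of the odd cycles of the pieces. -/
def cycleVerts {κ : Type*} {P : Option κ → Set V} (C : ∀ j, (G.induce (P (some j))).Subgraph) :
    ∀ i, Set (P i)
  | none => ∅
  | some j => (C j).verts

/-- The index `none` stands for the bipartite piece. By `hbd` edges between pieces never touch a
vertex of D of a piece, so the adjacency conditions can be checked inside one piece. -/
theorem exists_isCertificate {κ : Type*} [Finite V] [Finite κ] {P : Option κ → Set V}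
    {idx : V → Option κ} (hidx : ∀ v, v ∈ P (idx v)) (hP : ∀ i j v, v ∈ P i → v ∈ P j → i = j)
    (hB : (G.induce (P none)).IsBipartite) (C : ∀ j, (G.induce (P (some j))).Subgraph)
    (hC : ∀ j, IsFlowerGraph (G.induce (P (some j))) (C j))
    (hbd : ∀ i, ∀ v : P i, v ∈ geD (G.induce (P i)) → ∀ w, G.Adj v w → w ∈ P i) :
    ∃ (X A R : Set V) (Q : κ → Set V) (col : V → Bool), IsCertificate G X A R Q col := by
  classical
  set Y : ∀ i, Set (P i) := cycleVerts C with hY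
  have hYD : ∀ i, Y i ⊆ geD (G.induce (P i)) := by
    rintro (_ | j)
    · exact Set.empty_subset _
    · exact (hC j).verts_subset_geD
  have hind : ∀ i, ∀ u ∈ geD (G.induce (P i)), ∀ w ∈ geD (G.induce (P i)),
      (G.induce (P i)).Adj u w → u ∈ Y i ∧ w ∈ Y i := by
    rintro (_ | j) u hu w hw huw
    · exact (not_adj_of_mem_geD hB hu hw huw).elim
    · have := (hC j).adj_of_mem_geD hu hw huw
      exact ⟨(C j).edge_vert this, (C j).edge_vert this.symm⟩
  have hRnone : ∀ i, ∀ v ∈ geC (G.induce (P i)), i = none := by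
    rintro (_ | j) v hv
    · rfl
    · exact ((hC j).notMem_geC v hv).elim
  -- These are the tightness conditions within one piece; on an odd piece a matching that misses `f
  -- j` and is near perfect on the cycle satisfies them.
  have hloc : ∀ f : κ → V, (∀ j, ∃ h : f j ∈ P (some j), ⟨f j, h⟩ ∈ Y (some j)) → ∀ i,
      ∃ m : P i → P i, IsMaxPairing (G.induce (P i)) m ∧ (∀ j, ∀ v : P i, f j = v → m v = v) ∧
        (∀ z ∈ Y i, (∀ j, f j ≠ z) → m z ∈ Y i ∧ m z ≠ z) ∧
        (∀ a ∈ geA (G.induce (P i)), m a ∈ geD (G.induce (P i)) \ Y i) ∧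
        ∀ c ∈ geC (G.induce (P i)), m c ∈ geC (G.induce (P i)) ∧ m c ≠ c := by
    rintro f hf (_ | j)
    · obtain ⟨m, hm⟩ := exists_isMaxPairing (G.induce (P none))
      have hA := fun a (ha : a ∈ geA (G.induce (P none))) => apply_mem_geD_of_isBipartite hB hm ha
      refine ⟨m, hm, fun j v hv => ?_, fun z hz => hz.elim, fun a ha => ⟨hA a ha, fun h => h⟩,
        fun c hc => apply_mem_geC hm hA hc⟩
      obtain ⟨h, -⟩ := hf j
      exact absurd (hP _ _ _ h (hv ▸ v.2)) (by simp)
    · obtain ⟨h, hfj⟩ := hf j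
      obtain ⟨m, hm⟩ := (hC j).near _ hfj
      refine ⟨m, hm.max, fun j' v hv => ?_, fun z hz hzf => ?_, fun a ha =>
        ⟨(hC j).apply_mem_geD hm.max ha, (hC j).apply_notMem_verts hm ha⟩,
        fun c hc => ((hC j).notMem_geC c hc).elim⟩
      · obtain ⟨h', -⟩ := hf j'
        have : j' = j := Option.some_injective _ (hP _ _ _ h' (hv ▸ v.2))
        subst this
        have : v = ⟨f j', h⟩ := Subtype.ext hv.symm
        rw [this, hm.fix]
      · have := hm.adj z hz fun h' => hzf j (by rw [h'])
        exact ⟨(C j).edge_vert this.symm, ((C j).adj_sub this).ne'⟩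
  let X := liftSet P fun i => geD (G.induce (P i)) \ Y i
  let A := liftSet P fun i => geA (G.induce (P i))
  let R := liftSet P fun i => geC (G.induce (P i))
  let Q : κ → Set V := fun j => Subtype.val '' Y (some j)
  have hX : ∀ {i v} (h : v ∈ P i), v ∈ X ↔ _ := fun h => mem_liftSet hP h
  have hA : ∀ {i v} (h : v ∈ P i), v ∈ A ↔ _ := fun h => mem_liftSet hP h
  have hR : ∀ {i v} (h : v ∈ P i), v ∈ R ↔ _ := fun h => mem_liftSet hP h
  have hQ : ∀ {j v} (h : v ∈ P (some j)), v ∈ Q j ↔ ⟨v, h⟩ ∈ Y (some j) := by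
    intro j v h
    constructor
    · rintro ⟨w, hw, rfl⟩; exact hw
    · exact fun hw => ⟨_, hw, rfl⟩
  have hglue : ∀ (f : κ → V) (M : ∀ i, P i → P i), (∀ i, IsMaxPairing (G.induce (P i)) (M i) ∧
      (∀ j, ∀ v : P i, f j = v → M i v = v) ∧
        (∀ z ∈ Y i, (∀ j, f j ≠ z) → M i z ∈ Y i ∧ M i z ≠ z) ∧
        (∀ a ∈ geA (G.induce (P i)), M i a ∈ geD (G.induce (P i)) \ Y i) ∧
        ∀ c ∈ geC (G.induce (P i)), M i c ∈ geC (G.induce (P i)) ∧ M i c ≠ c) →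
      (∀ j, f j ∈ Q j) → IsTight G X A R Q f (glue hidx M) := by
    intro f M hM hf
    refine ⟨isPairing_glue hidx hP fun i => (hM i).1.1, fun j => ?_, ?_, fun a ha => ?_,
      fun c hc => ?_⟩
    · exact congrArg Subtype.val ((hM (idx (f j))).2.1 j ⟨f j, hidx _⟩ rfl)
    · rintro j _ ⟨z, hz, rfl⟩ hzf
      rw [glue_apply hidx hP z.2]
      have := (hM (some j)).2.2.1 z hz fun j' hj' => hzf ?_
      · exact ⟨⟨_, this.1, rfl⟩, fun h => this.2 (Subtype.ext h)⟩
      · obtain ⟨w, hw, hwf⟩ := hf j'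
        have : j' = j := Option.some_injective _ (hP _ _ _ w.2 (by rw [hwf, hj']; exact z.2))
        rw [← hj', this]
    · obtain ⟨i, hi, ha⟩ := ha
      rw [glue_apply hidx hP hi, hX (Subtype.property _)]
      exact (hM i).2.2.2.1 _ ha
    · obtain ⟨i, hi, hc⟩ := hc
      rw [glue_apply hidx hP hi, hR (Subtype.property _)]
      have := (hM i).2.2.2.2 _ hc
      exact ⟨this.1, fun h => this.2 (Subtype.ext h)⟩
  have hfY : ∀ f : κ → V, (∀ j, f j ∈ Q j) →
      ∀ j, ∃ h : f j ∈ P (some j), ⟨f j, h⟩ ∈ Y (some j) := by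
    intro f hf j
    obtain ⟨w, hw, hwf⟩ := hf j
    exact ⟨hwf ▸ w.2, (hQ _).1 (hf j)⟩
  obtain ⟨c⟩ := hB
  -- The default colour is harmless, since `R` lies entirely in the bipartite piece.
  refine ⟨X, A, R, Q, fun v => if h : v ∈ P none then decide (c ⟨v, h⟩ = 0) else false, ?_⟩
  have hcov : ∀ v, v ∈ X ∨ v ∈ A ∨ v ∈ R ∨ ∃ i, v ∈ Q i := by
    intro v
    have h := hidx v
    generalize idx v = i at h
    rw [hX h, hA h, hR h]
    by_cases hD : (⟨v, h⟩ : P i) ∈ geD (G.induce (P i))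
    · by_cases hv : (⟨v, h⟩ : P i) ∈ Y i
      · rcases i with _ | j
        · exact hv.elim
        · exact Or.inr (Or.inr (Or.inr ⟨j, (hQ h).2 hv⟩))
      · exact Or.inl ⟨hD, hv⟩
    · by_cases hv : (⟨v, h⟩ : P i) ∈ geA (G.induce (P i))
      · exact Or.inr (Or.inl hv)
      · exact Or.inr (Or.inr (Or.inl fun h' => h'.elim hD hv))
  exact
  { cover := hcov
    disjoint_XA := by
      rintro v ⟨i, h, hv⟩
      rw [hA h]
      exact fun h' => h'.1 hv.1
    disjoint_XR := by
      rintro v ⟨i, h, hv⟩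
      rw [hR h]
      exact fun h' => h' (Or.inl hv.1)
    disjoint_AR := by
      rintro v ⟨i, h, hv⟩
      rw [hR h]
      exact fun h' => h' (Or.inr hv)
    disjoint_Q := by
      rintro j _ ⟨v, hv, rfl⟩
      rw [hX v.2, hA v.2, hR v.2]
      exact ⟨fun h => h.2 hv, fun h => h.1 (hYD _ hv), fun h => h (Or.inl (hYD _ hv))⟩
    disjoint_QQ := by
      rintro j j' _ ⟨v, -, rfl⟩ ⟨w, -, hwv⟩
      exact Option.some_injective _ (hP _ _ _ v.2 (hwv ▸ w.2))
    odd := fun j => by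
      rw [Set.ncard_image_of_injective _ Subtype.val_injective]
      exact (hC j).odd
    adj_X := by
      rintro v ⟨i, h, hv⟩ w hvw
      have hw := hbd i ⟨v, h⟩ hv.1 w hvw
      rw [hA hw]
      exact ⟨fun hwD => hv.2 (hind i _ hv.1 ⟨w, hw⟩ hwD hvw).1, _, hv.1, hvw⟩
    adj_Q := by
      rintro j _ ⟨v, hv, rfl⟩ w hvw
      have hvD := hYD _ hv
      have hw := hbd _ v hvD w hvw
      rw [hA hw, hQ hw]
      by_cases hwD : (⟨w, hw⟩ : P (some j)) ∈ geD (G.induce (P (some j)))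
      · exact Or.inr (hind _ _ hvD ⟨w, hw⟩ hwD hvw).2
      · exact Or.inl ⟨hwD, v, hvD, hvw⟩
    exists_adj_Q := by
      rintro j _ ⟨v, hv, rfl⟩
      obtain ⟨n, f, -, hrange, hper, hadj, -, -⟩ := (hC j).cycle.exists_enumeration
      have hv' : v ∈ (C j).verts := hv
      rw [hrange] at hv'
      obtain ⟨i, rfl⟩ := hv'
      exact ⟨f (i + 1), ⟨_, (C j).edge_vert (hadj i).symm, rfl⟩, (C j).adj_sub (hadj i)⟩
    coloring := by
      rintro v ⟨i, h, hv⟩ w ⟨i', h', hw⟩ hvw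
      obtain rfl := hRnone i _ hv
      obtain rfl := hRnone i' _ hw
      have := c.valid (show (G.induce (P none)).Adj ⟨v, h⟩ ⟨w, h'⟩ from hvw)
      simp only [h, h', dif_pos, ne_eq, decide_eq_decide]
      omega
    exists_tight := by
      intro f hf
      choose M hM using hloc f (hfY f hf)
      exact ⟨_, hglue f M hM hf⟩
    exists_fix_X := by
      rintro v ⟨i, h, hv⟩
      obtain ⟨f, hf⟩ : ∃ f : κ → V, ∀ j, f j ∈ Q j := by
        refine Classical.skolem.1 fun j => ?_
        have := Set.nonempty_of_ncard_ne_zero (hC j).odd.pos.ne'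
        exact this.image _
      choose M hM using hloc f (hfY f hf)
      obtain ⟨m, hm, hmv⟩ := mem_geD_iff.1 hv.1
      -- Only the matching of the piece containing `v` is exchanged. The result need not be tight,
      -- but it misses as many vertices as the tight one.
      have hM' : ∀ i', IsMaxPairing (G.induce (P i')) (update M i m i') := by
        intro i'
        by_cases hi : i' = i
        · subst hi; simpa using hm
        · simpa [hi] using (hM i').1
      refine ⟨glue hidx (update M i m), _, f, hf, hglue f M hM hf,
        isPairing_glue hidx hP fun i' => (hM' i').1, ?_, ?_⟩
      · rw [glue_apply hidx hP h, update_self, hmv]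
      · exact ncard_fixedPoints_glue hidx hP fun i' => (hM' i').ncard_eq (hM i').1 }

theorem IsBABDecomposition.exists_isCertificate [Finite V] {k : ℕ} {B : Set V}
    {P : Fin k → Set V} (h : IsBABDecomposition G B P) :
    ∃ (X A R : Set V) (Q : Fin k → Set V) (col : V → Bool), IsCertificate G X A R Q col := by
  let P' : Option (Fin k) → Set V := fun i => i.elim B P
  have hcov : ∀ v, ∃ i, v ∈ P' i := by
    intro v
    have : v ∈ B ∪ ⋃ i, P i := by rw [h.cover]; trivial
    rcases this with hv | hv
    · exact ⟨none, hv⟩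
    · obtain ⟨i, hi⟩ := Set.mem_iUnion.1 hv
      exact ⟨some i, hi⟩
  choose idx hidx using hcov
  choose C hC hu using h.almostBipartite
  refine BAB.exists_isCertificate hidx ?_ h.bipartite C
    (fun j => isFlowerGraph_of_reachSet (hC j) (hu j) (h.reach j _ (hC j))) ?_
  · rintro (_ | i) (_ | j) v hi hj
    · rfl
    · exact (Set.disjoint_left.1 (h.disjoint_base j) hi hj).elim
    · exact (Set.disjoint_left.1 (h.disjoint_base i) hj hi).elim
    · by_contra hij
      exact Set.disjoint_left.1 (h.disjoint_parts i j fun h' => hij (by rw [h'])) hi hj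
  -- A vertex with a neighbour outside its piece lies in A or C of that piece, hence not in D.
  · rintro (_ | i) v hv w hvw
    · by_contra hw
      obtain ⟨u, hu, huv⟩ := h.boundary_base ⟨v.2, w, hw, hvw⟩
      obtain rfl := Subtype.ext huv
      exact hu.elim (fun h' => h'.1 hv) fun h' => h' (Or.inl hv)
    · by_contra hw
      obtain ⟨u, hu, huv⟩ := h.boundary_parts i ⟨v.2, w, hw, hvw⟩
      obtain rfl := Subtype.ext huv
      exact hu.1 hv

end Pieces

end BAB

theorem mainTheorem11 {V : Type*} [Finite V] (G : SimpleGraph V) (hG : BAB.IsBABGraph G) :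
    (BAB.closedNbhd G (BAB.diadem G) ∪ BAB.setY G = Set.univ ∧
      BAB.closedNbhd G (BAB.diadem G) ∩ BAB.setY G = ∅) ∧
    (BAB.nucleus G ∪ (BAB.geD G \ BAB.nucleus G) ∪ BAB.geA G ∪ BAB.geC G = Set.univ ∧
      [BAB.nucleus G, BAB.geD G \ BAB.nucleus G, BAB.geA G, BAB.geC G].Pairwise Disjoint) := by
  obtain ⟨k, B, P, h⟩ := hG
  obtain ⟨X, A, R, Q, col, hcert⟩ := h.exists_isCertificate
  rw [hcert.closedNbhd_diadem_eq]
  exact ⟨⟨Set.compl_union_self _, Set.compl_inter_self _⟩,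
    BAB.partition_of_nucleus_subset hcert.nucleus_subset_geD⟩
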